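/- Let $\Sigma$ be a finite alphabet, $k\in\mathbb N$, and let $\mathcal P(W)$ denote the set of probability measures on a finite set $W$. A $d$-dimensional semiconstrained system is a set $\Gamma\subseteq\mathcal P(\Sigma^S)$, where $S\subseteq\mathbb Z^d$ is finite. Put $F_n^d=\{0,\dots,n-1\}^d$. For $w\in\Sigma^{F_n^d}$ let $$\mathrm{fr}^S_w(a)=\frac1{n^d}\,\bigl|\{v\in F_n^d:\ w_{(v+s)\bmod n}=a_s\ \text{for all } s\in S\}\bigr|\qquad(a\in\Sigma^S)$$ be the cyclic empirical distribution of $w$, and let $\mathcal B_n(\Gamma)=\{w\in\Sigma^{F_n^d}:\ \mathrm{fr}^S_w\in\Gamma\}$. For $\epsilon>0$ let $\mathbb B_\epsilon(\Gamma)=\{\mu\in\mathcal P(\Sigma^S):\ \inf_{\nu\in\Gamma}\|\mu-\nu\|_{TV}\le\epsilon\}$, where $\|\cdot\|_{TV}$ is the total variation distance. The capacity of $\Gamma$ is $$\overline{\mathrm{cap}}(\Gamma)=\lim_{\epsilon\to0^+}\ \limsup_{n\to\infty}\ \frac1{n^d}\log_2\bigl|\mathcal B_n(\mathbb B_\epsilon(\Gamma))\bigr|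 .$$ Let $\overline{\mathcal P}_n(\Gamma)$ be the set of product probability measures $\mu=\prod_{v\in F_n^d}\mu_v$ on $\Sigma^{F_n^d}$ whose average marginal $\frac1{n^d}\sum_{v\in F_n^d}\pi_{S+v}(\mu)$ belongs to $\Gamma$; here $\pi_T$ denotes the $T$-marginal, coordinates are taken modulo $n$, and $\Sigma^{S+v}$ is identified with $\Sigma^S$. The independence entropy of $\Gamma$ is $$\overline h_{\mathrm{ind}}(\Gamma)=\lim_{\epsilon\to0^+}\ \limsup_{n\to\infty}\ \sup_{\mu\in\overline{\mathcal P}_n(\mathbb B_\epsilon(\Gamma))}\frac1{n^d}H(\mu),\qquad H(\mu)=-\sum_{w}\mu(w)\log_2\mu(w).$$ Conventions: $\log_2 0=\sup\emptyset=-\infty$ and $\inf\emptyset=+\infty$, so these quantities are extended real numbers. For a one-dimensional system $\Gamma\subseteq\mathcal P(\Sigma^k)$ (with $S=[k]=\{0,\dots,k-1\}\subseteq\mathbb Z$), its $d$-axial product is the $d$-dimensional system $$\Gamma^{\otimes d}=\Bigl\{\mu\in\mathcal P(\Sigma^{S_d}):\ \pi_{[k]e_i}(\mu)\in\Gamma\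 \text{ for } i=0,\dots,d-1\Bigr\},\qquad S_d=\bigcup_{i=0}^{d-1}[k]e_i\subseteq\mathbb Z^d,$$ where $e_0,\dots,e_{d-1}$ are the unit vectors and $\Sigma^{[k]e_i}$ is identified with $\Sigma^k$. **Theorem.** Let $k\in\mathbb N$ and let $\Gamma\subseteq\mathcal P(\Sigma^k)$ be a convex one-dimensional semiconstrained system. Then $$\limsup_{d\to\infty}\ \overline{\mathrm{cap}}(\Gamma^{\otimes d})=\overline h_{\mathrm{ind}}(\Gamma).$$ -/

import Mathlib

open Filter Topology

namespace Semiconstrained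

noncomputable section

/-! Throughout, a probability measure on a finite set `X` is identified with its vector of point
masses, i.e. with an element of `stdSimplex ℝ X`. -/

section Measures

/-- Total variation distance of two probability measures on a finite set
(half of the `ℓ¹` distance). -/
def tvDist {X : Type*} [Fintype X] (μ ν : X → ℝ) : ℝ :=
  (1 / 2) * ∑ x, |μ x - ν x|

/-- `𝔹_ε(Γ)`: all probability measures `μ` with `inf_{ν ∈ Γ} ‖μ - ν‖_TV ≤ ε`. The infimum is taken
in the extended reals, so that it is `+∞` for empty `Γ`. -/
def ball {X : Type*} [Fintype X] (ε : ℝ) (Γ : Set (X → ℝ)) : Set (X → ℝ) :=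
  {μ | μ ∈ stdSimplex ℝ X ∧ (⨅ ν ∈ Γ, ((tvDist μ ν : ℝ) : EReal)) ≤ (ε : EReal)}

/-- Push-forward of a measure along a map between finite sets; with `f` a restriction map this is
the marginal. -/
def pushforward {X Y : Type*} [Fintype X] [DecidableEq Y] (f : X → Y) (μ : X → ℝ) : Y → ℝ :=
  fun y => ∑ x with f x = y, μ x

/-- Shannon entropy in bits. -/
def entropy {X : Type*} [Fintype X] (μ : X → ℝ) : ℝ :=
  -∑ x, μ x * Real.logb 2 (μ x)

/-- The product measure `∏_v q_v` on `V → A`. -/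
def productMeasure {V A : Type*} [Fintype V] (q : V → A → ℝ) : (V → A) → ℝ :=
  fun w => ∏ v, q v (w v)

end Measures

/-- The cube `F_n^d = {0, …, n-1}^d`. -/
abbrev Cube (d n : ℕ) : Type := Fin d → Fin n

/-- `v + s` with coordinates taken modulo `n`. -/
def cyclicAdd {d n : ℕ} (v : Cube d n) (s : Fin d → ℤ) : Cube d n := fun i =>
  ⟨(((v i : ℕ) + s i : ℤ) % (n : ℤ)).toNat, by
    have hn : 0 < (n : ℤ) := by exact_mod_cast (v i).pos
    have h0 := Int.emod_nonneg (((v i : ℕ) : ℤ) + s i) hn.ne'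
    have h1 := Int.emod_lt_of_pos (((v i : ℕ) : ℤ) + s i) hn
    omega⟩

section Systems

/-! A finite window `S ⊆ ℤ^d` is given by a finite index type `ι` and the family `p : ι → ℤ^d` of
its positions (for a `Finset S`, `ι = S` and `p` is the inclusion), and `Σ^S` is `ι → A`. A
`d`-dimensional semiconstrained system is a set `Γ` of probability measures on `ι → A`. -/

variable {A : Type*} [Fintype A] [DecidableEq A] {d : ℕ}
  {ι : Type*} [Fintype ι] [DecidableEq ι]

/-- The pattern that `w` shows, cyclically, in the window `v + S`. -/
def pattern (p : ι → Fin d → ℤ) {n : ℕ} (v : Cube d n) (w : Cube d n → A) : ι → A :=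
  fun j => w (cyclicAdd v (p j))

/-- The empirical distribution `fr_w^S`. -/
def empirical (p : ι → Fin d → ℤ) {n : ℕ} (w : Cube d n → A) : (ι → A) → ℝ :=
  fun a => (1 / (n : ℝ) ^ d) * ∑ v : Cube d n, if pattern p v w = a then 1 else 0

/-- The admissible `n`-blocks `B_n(Γ)`. -/
def blocks (p : ι → Fin d → ℤ) (Γ : Set ((ι → A) → ℝ)) (n : ℕ) : Set (Cube d n → A) :=
  {w | empirical p w ∈ Γ}

/-- `log₂` of a natural number, with `log₂ 0 = -∞`. -/
def log2Card (N : ℕ) : EReal := if N = 0 then ⊥ else ((Real.logb 2 N : ℝ) : EReal)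

/-- The internal capacity `limsup_n n^{-d} log₂ |B_n(Γ)|`. -/
def internalCapacity (p : ι → Fin d → ℤ) (Γ : Set ((ι → A) → ℝ)) : EReal :=
  limsup (fun n : ℕ => log2Card (blocks p Γ n).ncard / (((n : ℝ) ^ d : ℝ) : EReal)) atTop

/-- The capacity `lim_{ε → 0⁺} limsup_n n^{-d} log₂ |B_n(𝔹_ε(Γ))|`. The limit exists, see
`tendsto_capacity`. -/
def capacity (p : ι → Fin d → ℤ) (Γ : Set ((ι → A) → ℝ)) : EReal :=
  limUnder (𝓝[>] (0 : ℝ)) fun ε => internalCapacity p (ball ε Γ)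

/-- The average of the `S`-marginals of `μ` over all cyclic translates of `S`. -/
def averageMarginal (p : ι → Fin d → ℤ) {n : ℕ} (μ : (Cube d n → A) → ℝ) : (ι → A) → ℝ :=
  fun a => (1 / (n : ℝ) ^ d) * ∑ v : Cube d n, pushforward (pattern p v) μ a

/-- The product probability measures on `A^{F_n^d}` whose average `S`-marginal lies in `Γ`. -/
def independentMeasures (p : ι → Fin d → ℤ) (Γ : Set ((ι → A) → ℝ)) (n : ℕ) :
    Set ((Cube d n → A) → ℝ) :=
  {μ | (∃ q : Cube d n → A → ℝ, (∀ v, q v ∈ stdSimplex ℝ A) ∧ μ = productMeasure q) ∧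
    averageMarginal p μ ∈ Γ}

/-- The internal independence entropy `limsup_n sup_μ n^{-d} H(μ)`, with `sup ∅ = -∞`. -/
def internalIndependenceEntropy (p : ι → Fin d → ℤ) (Γ : Set ((ι → A) → ℝ)) : EReal :=
  limsup (fun n : ℕ => ⨆ μ ∈ independentMeasures p Γ n,
    (((1 / (n : ℝ) ^ d) * entropy μ : ℝ) : EReal)) atTop

/-- The independence entropy: the limit of the internal independence entropy of `𝔹_ε(Γ)` as
`ε → 0⁺`. The limit exists, see `tendsto_independenceEntropy`. -/
def independenceEntropy (p : ι → Fin d → ℤ) (Γ : Set ((ι → A) → ℝ)) : EReal :=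
  limUnder (𝓝[>] (0 : ℝ)) fun ε => internalIndependenceEntropy p (ball ε Γ)

theorem ball_mono {X : Type*} [Fintype X] (Γ : Set (X → ℝ)) {ε δ : ℝ} (h : ε ≤ δ) :
    ball ε Γ ⊆ ball δ Γ :=
  fun _ hμ => ⟨hμ.1, hμ.2.trans (EReal.coe_le_coe_iff.2 h)⟩

theorem log2Card_mono {M N : ℕ} (h : M ≤ N) : log2Card M ≤ log2Card N := by
  unfold log2Card
  split_ifs with h1 h2
  · exact le_rfl
  · exact bot_le
  · omega
  · exact EReal.coe_le_coe_iff.2 (Real.logb_le_logb_of_le (by norm_num)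
      (by exact_mod_cast Nat.pos_of_ne_zero h1) (by exact_mod_cast h))

theorem internalCapacity_mono (p : ι → Fin d → ℤ) {Γ Δ : Set ((ι → A) → ℝ)} (h : Γ ⊆ Δ) :
    internalCapacity p Γ ≤ internalCapacity p Δ :=
  limsup_le_limsup (Eventually.of_forall fun n =>
    EReal.div_le_div_right_of_nonneg (EReal.coe_nonneg.2 (by positivity))
      (log2Card_mono (Set.ncard_le_ncard (fun _ hw => h hw) (Set.toFinite _))))

theorem internalIndependenceEntropy_mono (p : ι → Fin d → ℤ) {Γ Δ : Set ((ι → A) → ℝ)}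
    (h : Γ ⊆ Δ) : internalIndependenceEntropy p Γ ≤ internalIndependenceEntropy p Δ :=
  limsup_le_limsup (Eventually.of_forall fun _ =>
    biSup_mono fun _ hμ => ⟨hμ.1, h hμ.2⟩)

theorem tendsto_capacity (p : ι → Fin d → ℤ) (Γ : Set ((ι → A) → ℝ)) :
    Tendsto (fun ε => internalCapacity p (ball ε Γ)) (𝓝[>] (0 : ℝ)) (𝓝 (capacity p Γ)) :=
  tendsto_nhds_limUnder ⟨_, Monotone.tendsto_nhdsGT
    (fun _ _ h => internalCapacity_mono p (ball_mono Γ h)) 0⟩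

theorem tendsto_independenceEntropy (p : ι → Fin d → ℤ) (Γ : Set ((ι → A) → ℝ)) :
    Tendsto (fun ε => internalIndependenceEntropy p (ball ε Γ)) (𝓝[>] (0 : ℝ))
      (𝓝 (independenceEntropy p Γ)) :=
  tendsto_nhds_limUnder ⟨_, Monotone.tendsto_nhdsGT
    (fun _ _ h => internalIndependenceEntropy_mono p (ball_mono Γ h)) 0⟩

end Systems

section AxialProduct

/-- The one-dimensional window `[k] = {0, …, k-1} ⊆ ℤ`, indexed by `Fin k`. -/
def segment (k : ℕ) : Fin k → Fin 1 → ℤ := fun j _ => ((j : ℕ) : ℤ)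

/-- The window `⋃_i [k] e_i ⊆ ℤ^d`. -/
def axialShape (d k : ℕ) : Finset (Fin d → ℤ) :=
  Finset.univ.image fun ij : Fin d × Fin k => Pi.single ij.1 (((ij.2 : ℕ) : ℤ))

theorem single_mem_axialShape {d k : ℕ} (i : Fin d) (j : Fin k) :
    (Pi.single i (((j : ℕ) : ℤ)) : Fin d → ℤ) ∈ axialShape d k :=
  Finset.mem_image.2 ⟨(i, j), Finset.mem_univ _, rfl⟩

/-- The positions of the window `⋃_i [k] e_i`. -/
def axialWindow (d k : ℕ) : axialShape d k → Fin d → ℤ := Subtype.val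

/-- Restriction of a pattern on `⋃_i [k] e_i` to `[k] e_i`, read as a word of length `k`. -/
def axisRestrict {A : Type*} {d k : ℕ} (i : Fin d) (x : axialShape d k → A) : Fin k → A :=
  fun j => x ⟨Pi.single i (((j : ℕ) : ℤ)), single_mem_axialShape i j⟩

/-- The `d`-axial product `Γ^{⊗d}` of a one-dimensional system `Γ ⊆ P(A^k)`: the probability
measures on `A^S`, `S = ⋃_i [k] e_i`, all of whose marginals on `[k] e_i` belong to `Γ`. -/
def axialProduct {A : Type*} [Fintype A] [DecidableEq A] {k : ℕ} (d : ℕ)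
    (Γ : Set ((Fin k → A) → ℝ)) : Set ((axialShape d k → A) → ℝ) :=
  {μ | μ ∈ stdSimplex ℝ (axialShape d k → A) ∧ ∀ i : Fin d, pushforward (axisRestrict i) μ ∈ Γ}

end AxialProduct

end

end Semiconstrained

/-! The two inequalities are independent. The lower bound on the capacity holds in every dimension
`d ≥ 1`; convexity and large `d` enter only in the upper bound.

Upper bound (`limsup_capacity_le`). Take a uniformly random admissible word `X` on the
`d`-dimensional torus. Reveal its values on a random set `F` of density `1/(m+1)`. A fixed point has
`d` disjoint axis tails of `k - 1` points. Adding one of these to `F` at random barely changes the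
law of `F` when `d` is large, by a second moment estimate, so on average over the axes the tail
carries little new information about the point. Hence for some sparse `F` and some axis, the windows
along that axis have small total correlation given `X_F` (`exists_card_add_totalCorrelation_le`). By
Pinsker's inequality their conditional laws are close to products of their marginals. Averaged over
samples and positions, the true window laws give a mean of axis marginals of empirical
distributions; it lies near `Γ` because `Γ` is convex. The conditional one-point laws read along the
axis from every starting point, and concatenated, therefore form a one-dimensional product measure
nearly admissible for `Γ` (`le_internalIndependenceEntropy`). Its entropy rate is that of `X` up to
the cost of revealing `F` (`card_mul_logb_card_le`). All error terms are uniform in the side `n`.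

Lower bound (`independenceEntropy_le_capacity_axialProduct`). Spread a one-dimensional product
measure of period `n` over a torus of side divisible by `n`, letting the law at `v` depend only on
the sum of the coordinates of `v`. Every axis then sees the original measure, and the entropy rate
is unchanged. By Chebyshev's inequality a typical word has empirical distribution close to the mean
marginal, and there are enough typical words to account for the entropy (`sum_tvDist_gt_le`,
`entropy_le_of_concentrated`). The mean marginal has axis marginals only near `Γ`; its symmetry in
the axes allows a small correction that puts it into the axial product (`exists_axis_marginals_eq`).
-/

set_option linter.unusedSectionVars false

namespace Semiconstrained

/-! ### Total variation, push-forwards, entropy and product measures -/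

section Basics

variable {X Y V A ι : Type*} [Fintype X] [Fintype Y] [Fintype V] [Fintype A] [Fintype ι]

theorem tvDist_triangle (μ ν ρ : X → ℝ) : tvDist μ ρ ≤ tvDist μ ν + tvDist ν ρ := by
  unfold tvDist
  rw [← mul_add, ← Finset.sum_add_distrib]
  gcongr with x
  exact abs_sub_le _ _ _

theorem tvDist_comm (μ ν : X → ℝ) : tvDist μ ν = tvDist ν μ := by
  simp only [tvDist, abs_sub_comm]

theorem mem_ball_of_tvDist_le {ε : ℝ} {Γ : Set (X → ℝ)} {μ ν : X → ℝ} (hμ : μ ∈ stdSimplex ℝ X)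
    (hν : ν ∈ Γ) (h : tvDist μ ν ≤ ε) : μ ∈ ball ε Γ :=
  ⟨hμ, (iInf₂_le ν hν).trans (EReal.coe_le_coe_iff.2 h)⟩

/-- The infimum defining the ball need not be attained, as `Γ` is not assumed closed; hence the
strictly larger radius. -/
theorem exists_tvDist_lt_of_mem_ball {ε δ : ℝ} {Γ : Set (X → ℝ)} {μ : X → ℝ} (h : μ ∈ ball ε Γ)
    (hδ : ε < δ) : ∃ ν ∈ Γ, tvDist μ ν < δ := by
  have h1 : (⨅ ν ∈ Γ, ((tvDist μ ν : ℝ) : EReal)) < (δ : EReal) :=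
    h.2.trans_lt (EReal.coe_lt_coe_iff.2 hδ)
  simp only [iInf_lt_iff] at h1
  obtain ⟨ν, hν, h2⟩ := h1
  exact ⟨ν, hν, EReal.coe_lt_coe_iff.1 h2⟩

theorem sum_pushforward_mul [DecidableEq Y] (f : X → Y) (μ : X → ℝ) (g : Y → ℝ) :
    ∑ y, pushforward f μ y * g y = ∑ x, μ x * g (f x) := by
  simp only [pushforward, Finset.sum_mul]
  rw [← Finset.sum_fiberwise Finset.univ f]
  refine Finset.sum_congr rfl fun y _ => Finset.sum_congr rfl fun x hx => ?_
  rw [(Finset.mem_filter.1 hx).2]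

theorem sum_pushforward [DecidableEq Y] (f : X → Y) (μ : X → ℝ) :
    ∑ y, pushforward f μ y = ∑ x, μ x := by
  simpa using sum_pushforward_mul f μ fun _ => 1

theorem pushforward_mem_stdSimplex [DecidableEq Y] (f : X → Y) {μ : X → ℝ}
    (hμ : μ ∈ stdSimplex ℝ X) : pushforward f μ ∈ stdSimplex ℝ Y :=
  ⟨fun _ => Finset.sum_nonneg fun x _ => hμ.1 x, by rw [sum_pushforward, hμ.2]⟩

theorem tvDist_pushforward_le [DecidableEq Y] (f : X → Y) (μ ν : X → ℝ) :
    tvDist (pushforward f μ) (pushforward f ν) ≤ tvDist μ ν := by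
  unfold tvDist
  gcongr
  rw [← Finset.sum_fiberwise Finset.univ f]
  gcongr with y
  simp only [pushforward]
  rw [← Finset.sum_sub_distrib]
  exact Finset.abs_sum_le_sum_abs _ _

/-- Gibbs' inequality. -/
theorem entropy_le_cross_entropy {p r : X → ℝ} (hp : p ∈ stdSimplex ℝ X) (hr : ∀ x, 0 ≤ r x)
    (hr1 : ∑ x, r x ≤ 1) (h : ∀ x, p x ≠ 0 → r x ≠ 0) :
    entropy p ≤ -∑ x, p x * Real.logb 2 (r x) := by
  have hlog : 0 < Real.log 2 := Real.log_pos (by norm_num)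
  have key : ∑ x, p x * (Real.log (r x) - Real.log (p x)) ≤ 0 := by
    calc ∑ x, p x * (Real.log (r x) - Real.log (p x)) ≤ ∑ x, (r x - p x) := by
          refine Finset.sum_le_sum fun x _ => ?_
          by_cases h0 : p x = 0
          · simp [h0, hr x]
          have hpx : 0 < p x := lt_of_le_of_ne (hp.1 x) (Ne.symm h0)
          have hrx : 0 < r x := lt_of_le_of_ne (hr x) (Ne.symm (h x h0))
          rw [← Real.log_div hrx.ne' hpx.ne']
          have := Real.log_le_sub_one_of_pos (div_pos hrx hpx)
          calc p x * Real.log (r x / p x) ≤ p x * (r x / p x - 1) := by gcongr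
            _ = r x - p x := by field_simp
      _ ≤ 0 := by rw [Finset.sum_sub_distrib, hp.2]; linarith
  have : ∑ x, p x * Real.logb 2 (r x) - ∑ x, p x * Real.logb 2 (p x)
      = (∑ x, p x * (Real.log (r x) - Real.log (p x))) / Real.log 2 := by
    rw [← Finset.sum_sub_distrib, Finset.sum_div]
    refine Finset.sum_congr rfl fun x _ => ?_
    simp only [Real.logb]
    ring
  have h2 := div_nonpos_of_nonpos_of_nonneg key hlog.le
  unfold entropy
  linarith

theorem entropy_nonneg {p : X → ℝ} (hp : p ∈ stdSimplex ℝ X) : 0 ≤ entropy p := by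
  unfold entropy
  rw [neg_nonneg]
  refine Finset.sum_nonpos fun x _ => mul_nonpos_of_nonneg_of_nonpos (hp.1 x) ?_
  exact Real.logb_nonpos (by norm_num) (hp.1 x)
    (hp.2 ▸ Finset.single_le_sum (fun y _ => hp.1 y) (Finset.mem_univ x))

theorem entropy_le_logb_card {p : X → ℝ} (hp : p ∈ stdSimplex ℝ X) :
    entropy p ≤ Real.logb 2 (Fintype.card X) := by
  have hX : Nonempty X := by
    by_contra hX
    rw [not_nonempty_iff] at hX
    have := hp.2
    simp at this
  have hc : (Fintype.card X : ℝ) ≠ 0 := by exact_mod_cast Fintype.card_ne_zero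
  refine (entropy_le_cross_entropy (r := fun _ => (Fintype.card X : ℝ)⁻¹) hp
    (fun _ => by positivity) (by simp [hc]) (fun _ _ => inv_ne_zero hc)).trans ?_
  rw [← Finset.sum_mul, hp.2, Real.logb_inv]
  simp

theorem productMeasure_nonneg {q : V → A → ℝ} (hq : ∀ v, q v ∈ stdSimplex ℝ A) (w : V → A) :
    0 ≤ productMeasure q w :=
  Finset.prod_nonneg fun v _ => (hq v).1 _

theorem productMeasure_mem_stdSimplex [DecidableEq V] {q : V → A → ℝ}
    (hq : ∀ v, q v ∈ stdSimplex ℝ A) : productMeasure q ∈ stdSimplex ℝ (V → A) := by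
  refine ⟨productMeasure_nonneg hq, ?_⟩
  simp only [productMeasure]
  rw [← Fintype.prod_sum]
  simp [(hq _).2]

/-- The fibre over `a` is a box: coordinates in the range of `φ` are prescribed, and the free ones
each contribute total mass 1. -/
theorem pushforward_productMeasure [DecidableEq V] [DecidableEq A] [DecidableEq ι] {q : V → A → ℝ}
    (hq : ∀ v, q v ∈ stdSimplex ℝ A) {φ : ι → V} (hφ : Function.Injective φ) :
    pushforward (fun w j => w (φ j)) (productMeasure q) = productMeasure fun j => q (φ j) := by
  funext a
  have hset : (Finset.univ.filter fun w : V → A => (fun j => w (φ j)) = a) =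
      Fintype.piFinset fun v => Finset.univ.filter fun b => ∀ j, φ j = v → b = a j := by
    ext w
    simp only [Finset.mem_filter, Finset.mem_univ, true_and, Fintype.mem_piFinset]
    constructor
    · rintro rfl v j rfl
      rfl
    · exact fun h => funext fun j => h (φ j) j rfl
  simp only [pushforward, productMeasure]
  rw [hset, ← Finset.prod_univ_sum, ← Finset.prod_subset (Finset.subset_univ
    (Finset.univ.image φ)), Finset.prod_image fun _ _ _ _ h => hφ h]
  · refine Finset.prod_congr rfl fun j _ => ?_
    have : (Finset.univ.filter fun b => ∀ j', φ j' = φ j → b = a j') = {a j} := by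
      ext b
      simp [hφ.eq_iff]
    rw [this, Finset.sum_singleton]
  · intro v _ hv
    have : (Finset.univ.filter fun b => ∀ j, φ j = v → b = a j) = Finset.univ := by
      refine Finset.filter_true_of_mem fun b _ j hj => ?_
      exact absurd (Finset.mem_image.2 ⟨j, Finset.mem_univ j, hj⟩) hv
    rw [this, (hq v).2]

theorem sum_productMeasure_mul [DecidableEq V] [DecidableEq A] [DecidableEq ι] {q : V → A → ℝ}
    (hq : ∀ v, q v ∈ stdSimplex ℝ A) {φ : ι → V} (hφ : Function.Injective φ) (g : (ι → A) → ℝ) :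
    ∑ w, productMeasure q w * g (fun j => w (φ j)) =
      ∑ a, productMeasure (fun j => q (φ j)) a * g a := by
  rw [← pushforward_productMeasure hq hφ, sum_pushforward_mul]

theorem sum_productMeasure_mul_apply [DecidableEq V] [DecidableEq A] {q : V → A → ℝ}
    (hq : ∀ v, q v ∈ stdSimplex ℝ A) (v : V) (g : A → ℝ) :
    ∑ w, productMeasure q w * g (w v) = ∑ a, q v a * g a := by
  have h := sum_productMeasure_mul (ι := Unit) hq (φ := fun _ => v)
    (Function.injective_of_subsingleton _) fun a => g (a ())
  rw [h]
  refine Fintype.sum_equiv (Equiv.funUnique Unit A) _ _ fun a => ?_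
  simp [productMeasure]

theorem entropy_productMeasure [DecidableEq V] [DecidableEq A] {q : V → A → ℝ}
    (hq : ∀ v, q v ∈ stdSimplex ℝ A) : entropy (productMeasure q) = ∑ v, entropy (q v) := by
  have h : ∀ w : V → A, productMeasure q w * Real.logb 2 (productMeasure q w) =
      ∑ v, productMeasure q w * Real.logb 2 (q v (w v)) := by
    intro w
    by_cases h0 : productMeasure q w = 0
    · simp [h0]
    · rw [← Finset.mul_sum]
      congr 1
      have h0 : ∀ v ∈ Finset.univ, q v (w v) ≠ 0 := Finset.prod_ne_zero_iff.1 h0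
      simp only [productMeasure, Real.logb, ← Finset.sum_div]
      rw [Real.log_prod h0]
  simp only [entropy, h]
  rw [Finset.sum_comm, Finset.sum_neg_distrib]
  congr 1
  exact Finset.sum_congr rfl fun v _ =>
    sum_productMeasure_mul_apply hq v fun a => Real.logb 2 (q v a)

end Basics

/-! ### Translations of the discrete torus -/

section CyclicAdd

variable {d n : ℕ}

theorem cyclicAdd_apply (v : Cube d n) (s : Fin d → ℤ) (i : Fin d) :
    ((cyclicAdd v s i : ℕ) : ℤ) = ((v i : ℕ) + s i) % n := by
  have hn : 0 < (n : ℤ) := by exact_mod_cast (v i).pos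
  simp only [cyclicAdd]
  exact Int.toNat_of_nonneg (Int.emod_nonneg _ hn.ne')

theorem cube_ext {v w : Cube d n} (h : ∀ i, ((v i : ℕ) : ℤ) = (w i : ℕ)) : v = w :=
  funext fun i => Fin.ext (by exact_mod_cast h i)

theorem cyclicAdd_cyclicAdd (v : Cube d n) (s t : Fin d → ℤ) :
    cyclicAdd (cyclicAdd v s) t = cyclicAdd v (s + t) := by
  refine cube_ext fun i => ?_
  simp only [cyclicAdd_apply, Pi.add_apply]
  rw [Int.emod_add_emod, add_assoc]

theorem cyclicAdd_zero (v : Cube d n) : cyclicAdd v 0 = v := by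
  refine cube_ext fun i => ?_
  rw [cyclicAdd_apply, Pi.zero_apply, add_zero]
  exact Int.emod_eq_of_lt (by positivity) (by exact_mod_cast (v i).isLt)

/-- Cyclic translation by `s`. -/
def translate (s : Fin d → ℤ) : Cube d n ≃ Cube d n where
  toFun v := cyclicAdd v s
  invFun v := cyclicAdd v (-s)
  left_inv v := by
    beta_reduce
    rw [cyclicAdd_cyclicAdd, add_neg_cancel, cyclicAdd_zero]
  right_inv v := by
    beta_reduce
    rw [cyclicAdd_cyclicAdd, neg_add_cancel, cyclicAdd_zero]

theorem sum_cyclicAdd (s : Fin d → ℤ) (f : Cube d n → ℝ) :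
    ∑ v, f (cyclicAdd v s) = ∑ v, f v :=
  Equiv.sum_comp (translate s) f

theorem cyclicAdd_eq_cyclicAdd_iff (v w : Cube d n) (s t : Fin d → ℤ) :
    cyclicAdd v s = cyclicAdd w t ↔
      ∀ i, ((v i : ℕ) : ℤ) + s i ≡ ((w i : ℕ) : ℤ) + t i [ZMOD n] := by
  constructor
  · intro h i
    rw [Int.ModEq, ← cyclicAdd_apply, ← cyclicAdd_apply, h]
  · intro h
    refine cube_ext fun i => ?_
    rw [cyclicAdd_apply, cyclicAdd_apply]
    exact h i

theorem cyclicAdd_modEq (v : Cube d n) (s : Fin d → ℤ) (i : Fin d) :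
    ((cyclicAdd v s i : ℕ) : ℤ) ≡ (v i : ℕ) + s i [ZMOD n] := by
  rw [cyclicAdd_apply]
  exact Int.mod_modEq _ _

theorem card_cube (d n : ℕ) : (Fintype.card (Cube d n) : ℝ) = (n : ℝ) ^ d := by
  simp

end CyclicAdd

/-! ### Pinsker's inequality -/

section Pinsker

variable {X : Type*} [Fintype X]

/-- A form of Pinsker's inequality, obtained from the Hellinger distance. -/
theorem sq_sum_abs_sub_le {P Q : X → ℝ} (hP : P ∈ stdSimplex ℝ X) (hQ : Q ∈ stdSimplex ℝ X)
    (h : ∀ x, P x ≠ 0 → Q x ≠ 0) :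
    (∑ x, |P x - Q x|) ^ 2 ≤ 4 * ∑ x, P x * (Real.logb 2 (P x) - Real.logb 2 (Q x)) := by
  have hlog : 0 < Real.log 2 := Real.log_pos (by norm_num)
  set C := ∑ x, √(P x) * √(Q x) with hC
  have hC0 : 0 ≤ C := Finset.sum_nonneg fun x _ => by positivity
  have hsq : ∀ x, √(P x) ^ 2 = P x := fun x => Real.sq_sqrt (hP.1 x)
  have hsq' : ∀ x, √(Q x) ^ 2 = Q x := fun x => Real.sq_sqrt (hQ.1 x)
  have hm : ∑ x, (√(P x) - √(Q x)) ^ 2 = 2 - 2 * C := by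
    simp only [sub_sq, hsq, hsq', mul_assoc, Finset.sum_add_distrib, Finset.sum_sub_distrib,
      ← Finset.mul_sum, hP.2, hQ.2]
    ring
  have hp : ∑ x, (√(P x) + √(Q x)) ^ 2 = 2 + 2 * C := by
    simp only [add_sq, hsq, hsq', mul_assoc, Finset.sum_add_distrib,
      ← Finset.mul_sum, hP.2, hQ.2]
    ring
  have hm0 : 0 ≤ 2 - 2 * C := hm ▸ Finset.sum_nonneg fun x _ => sq_nonneg _
  -- The divergence dominates the squared Hellinger distance: apply `log t ≤ t - 1` with `t = √(Q x)
  -- / √(P x)`.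
  have hKL : 2 - 2 * C ≤ ∑ x, P x * (Real.log (P x) - Real.log (Q x)) := by
    have : 2 - 2 * C = ∑ x, (2 * P x - 2 * (√(P x) * √(Q x))) := by
      rw [Finset.sum_sub_distrib, ← Finset.mul_sum, ← Finset.mul_sum, hP.2]
      ring
    rw [this]
    refine Finset.sum_le_sum fun x _ => ?_
    by_cases h0 : P x = 0
    · simp [h0]
    have hPx : 0 < P x := lt_of_le_of_ne (hP.1 x) (Ne.symm h0)
    have hQx : 0 < Q x := lt_of_le_of_ne (hQ.1 x) (Ne.symm (h x h0))
    have h1 := Real.log_le_sub_one_of_pos (div_pos (Real.sqrt_pos.2 hQx) (Real.sqrt_pos.2 hPx))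
    rw [Real.log_div (Real.sqrt_pos.2 hQx).ne' (Real.sqrt_pos.2 hPx).ne', Real.log_sqrt hPx.le,
      Real.log_sqrt hQx.le] at h1
    have h2 : P x * (√(Q x) / √(P x)) = √(P x) * √(Q x) := by
      have := (Real.sqrt_pos.2 hPx).ne'
      nth_rewrite 1 [← hsq x]
      field_simp
    nlinarith
  have hbits : ∑ x, P x * (Real.log (P x) - Real.log (Q x)) ≤
      ∑ x, P x * (Real.logb 2 (P x) - Real.logb 2 (Q x)) := by
    have : ∑ x, P x * (Real.logb 2 (P x) - Real.logb 2 (Q x)) =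
        (∑ x, P x * (Real.log (P x) - Real.log (Q x))) / Real.log 2 := by
      rw [Finset.sum_div]
      refine Finset.sum_congr rfl fun x _ => ?_
      simp only [Real.logb]
      ring
    rw [this, le_div_iff₀ hlog]
    -- The divergence in nats is nonnegative by `hm0` and `hKL`, so division by `log 2 ≤ 1` does not
    -- decrease it.
    have : Real.log 2 ≤ 1 := by have := Real.log_two_lt_d9; linarith
    nlinarith
  have habs : ∀ x, |P x - Q x| = |√(P x) - √(Q x)| * (√(P x) + √(Q x)) := by
    intro x
    have h0 : 0 ≤ √(P x) + √(Q x) := by positivity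
    have h1 : P x - Q x = (√(P x) - √(Q x)) * (√(P x) + √(Q x)) := by
      nlinarith [hsq x, hsq' x]
    rw [h1, abs_mul, abs_of_nonneg h0]
  calc (∑ x, |P x - Q x|) ^ 2
      = (∑ x, |√(P x) - √(Q x)| * (√(P x) + √(Q x))) ^ 2 := by simp only [habs]
    _ ≤ (∑ x, |√(P x) - √(Q x)| ^ 2) * ∑ x, (√(P x) + √(Q x)) ^ 2 :=
        Finset.sum_mul_sq_le_sq_mul_sq _ _ _
    _ = (2 - 2 * C) * (2 + 2 * C) := by simp only [sq_abs, hm, hp]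
    -- `hm0` gives `C ≤ 1`, so the factor `2 + 2 * C` is at most 4.
    _ ≤ 4 * ∑ x, P x * (Real.logb 2 (P x) - Real.logb 2 (Q x)) := by nlinarith

end Pinsker

/-! ### Conditional entropy of a uniform sample by counting classes -/

section ConditionalEntropy

variable {Ω V A T : Type*} [Fintype Ω] [Fintype V] [Fintype A] [Fintype T]
  [DecidableEq V] [DecidableEq A] [DecidableEq T]

/-- The number of sample points that agree with `x` on `F`. -/
def classCard (X : Ω → V → A) (F : Finset V) (x : Ω) : ℕ :=
  (Finset.univ.filter fun y => ∀ v ∈ F, X y v = X x v).card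

/-- The conditional law of `Y`, for the uniform measure on `Ω`, given the values of `X` on `F` at
the sample point `x`. -/
noncomputable def condDist (X : Ω → V → A) (F : Finset V) (Y : Ω → T) (x : Ω) (t : T) : ℝ :=
  ((Finset.univ.filter fun y => (∀ v ∈ F, X y v = X x v) ∧ Y y = t).card : ℝ) / classCard X F x

/-- The sum over the sample points of the logarithms of their class sizes. -/
noncomputable def sumLogClass (X : Ω → V → A) (F : Finset V) : ℝ :=
  ∑ x, Real.logb 2 (classCard X F x)

/-- `|Ω|` times the conditional entropy of `X_v` given `X_F`. -/
noncomputable def condEntropy (X : Ω → V → A) (F : Finset V) (v : V) : ℝ :=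
  sumLogClass X F - sumLogClass X (insert v F)

variable (X : Ω → V → A) (F : Finset V)

theorem classCard_pos (x : Ω) : 0 < classCard X F x :=
  Finset.card_pos.2 ⟨x, by simp⟩

theorem classCard_congr {x y : Ω} (h : ∀ v ∈ F, X y v = X x v) :
    classCard X F y = classCard X F x := by
  unfold classCard
  congr 1
  refine Finset.filter_congr fun z _ => forall₂_congr fun v hv => ?_
  rw [h v hv]

theorem condDist_congr (Y : Ω → T) {x y : Ω} (h : ∀ v ∈ F, X y v = X x v) :
    condDist X F Y y = condDist X F Y x := by
  funext t
  unfold condDist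
  rw [classCard_congr X F h]
  congr 3
  refine Finset.filter_congr fun z _ => and_congr_left fun _ => forall₂_congr fun v hv => ?_
  rw [h v hv]

theorem sum_condDist_mul (Y : Ω → T) (x : Ω) (g : T → ℝ) :
    ∑ t, condDist X F Y x t * g t =
      (∑ y with ∀ v ∈ F, X y v = X x v, g (Y y)) / classCard X F x := by
  rw [← Finset.sum_fiberwise _ Y, Finset.sum_div]
  refine Finset.sum_congr rfl fun t _ => ?_
  rw [Finset.sum_congr rfl fun y hy => by rw [(Finset.mem_filter.1 hy).2], Finset.sum_const,
    nsmul_eq_mul, Finset.filter_filter, condDist]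
  ring

theorem condDist_mem_stdSimplex (Y : Ω → T) (x : Ω) : condDist X F Y x ∈ stdSimplex ℝ T := by
  refine ⟨fun t => by unfold condDist; positivity, ?_⟩
  have h := sum_condDist_mul X F Y x fun _ => 1
  have h0 : (classCard X F x : ℝ) ≠ 0 := by exact_mod_cast (classCard_pos X F x).ne'
  simp only [mul_one] at h
  rw [h]
  simp only [Finset.sum_const, nsmul_eq_mul, mul_one]
  exact div_self h0

/-- The law of total expectation. -/
theorem sum_sum_condDist_mul (Y : Ω → T) (ψ : Ω → T → ℝ)
    (hψ : ∀ x y, (∀ v ∈ F, X y v = X x v) → ψ y = ψ x) :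
    ∑ x, ∑ t, condDist X F Y x t * ψ x t = ∑ x, ψ x (Y x) := by
  have h1 : ∀ x, ∑ t, condDist X F Y x t * ψ x t =
      ∑ y, if ∀ v ∈ F, X y v = X x v then ψ y (Y y) / classCard X F y else 0 := by
    intro x
    rw [sum_condDist_mul, Finset.sum_div, Finset.sum_filter]
    refine Finset.sum_congr rfl fun y _ => ?_
    split_ifs with h
    · rw [hψ x y h, classCard_congr X F h]
    · rfl
  simp only [h1]
  rw [Finset.sum_comm]
  refine Finset.sum_congr rfl fun y _ => ?_
  have h0 : (classCard X F y : ℝ) ≠ 0 := by exact_mod_cast (classCard_pos X F y).ne'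
  rw [← Finset.sum_filter, Finset.sum_const, nsmul_eq_mul]
  have : (Finset.univ.filter fun x => ∀ v ∈ F, X y v = X x v).card = classCard X F y := by
    unfold classCard
    congr 1
    exact Finset.filter_congr fun z _ => forall₂_congr fun v _ => eq_comm
  rw [this]
  field_simp

theorem sum_entropy_condDist (Y : Ω → T) :
    ∑ x, entropy (condDist X F Y x) = -∑ x, Real.logb 2 (condDist X F Y x (Y x)) := by
  simp only [entropy, Finset.sum_neg_distrib]
  rw [sum_sum_condDist_mul X F Y fun x t => Real.logb 2 (condDist X F Y x t)]
  intro x y h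
  rw [condDist_congr X F Y h]

theorem condDist_self_pos (Y : Ω → T) (x : Ω) : 0 < condDist X F Y x (Y x) := by
  unfold condDist
  have h1 := classCard_pos X F x
  have h2 : 0 < (Finset.univ.filter fun y => (∀ v ∈ F, X y v = X x v) ∧ Y y = Y x).card :=
    Finset.card_pos.2 ⟨x, by simp⟩
  positivity

/-- Under a uniform sample, conditional probabilities are ratios of class sizes, so their logarithms
telescope. -/
theorem logb_condDist_apply (v : V) (x : Ω) :
    Real.logb 2 (condDist X F (fun y => X y v) x (X x v)) =
      Real.logb 2 (classCard X (insert v F) x) - Real.logb 2 (classCard X F x) := by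
  have h1 : condDist X F (fun y => X y v) x (X x v) =
      classCard X (insert v F) x / classCard X F x := by
    unfold condDist
    congr 2
    unfold classCard
    congr 1
    refine Finset.filter_congr fun y _ => ?_
    simp [and_comm]
  have h2 := classCard_pos X F x
  have h3 := classCard_pos X (insert v F) x
  rw [h1, Real.logb_div (by positivity) (by positivity)]

theorem sum_entropy_condDist_apply (v : V) :
    ∑ x, entropy (condDist X F (fun y => X y v) x) = condEntropy X F v := by
  rw [sum_entropy_condDist, condEntropy, sumLogClass, sumLogClass]
  simp only [logb_condDist_apply, Finset.sum_sub_distrib]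
  ring

theorem condEntropy_nonneg (v : V) : 0 ≤ condEntropy X F v := by
  rw [← sum_entropy_condDist_apply]
  exact Finset.sum_nonneg fun x _ => entropy_nonneg (condDist_mem_stdSimplex X F _ x)

theorem condEntropy_le (v : V) :
    condEntropy X F v ≤ Fintype.card Ω * Real.logb 2 (Fintype.card A) := by
  rw [← sum_entropy_condDist_apply]
  refine (Finset.sum_le_sum fun x _ =>
    entropy_le_logb_card (condDist_mem_stdSimplex X F _ x)).trans ?_
  simp

/-- Conditioning on more coordinates decreases the entropy. -/
theorem condEntropy_anti {F G : Finset V} (hFG : F ⊆ G) (v : V) :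
    condEntropy X G v ≤ condEntropy X F v := by
  have hlog : 0 < Real.log 2 := Real.log_pos (by norm_num)
  set cF : Ω → ℝ := fun x => classCard X F x
  set cG : Ω → ℝ := fun x => classCard X G x
  set cvF : Ω → ℝ := fun x => classCard X (insert v F) x
  set cvG : Ω → ℝ := fun x => classCard X (insert v G) x
  have pF : ∀ x, 0 < cF x := fun x => Nat.cast_pos.2 (classCard_pos X F x)
  have pG : ∀ x, 0 < cG x := fun x => Nat.cast_pos.2 (classCard_pos X G x)
  have pvF : ∀ x, 0 < cvF x := fun x => Nat.cast_pos.2 (classCard_pos X _ x)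
  have pvG : ∀ x, 0 < cvG x := fun x => Nat.cast_pos.2 (classCard_pos X _ x)
  -- For fixed `y` and `z`, all compatible `x` lie in a single class of `insert v G`, so the sum has
  -- at most `cvG x` equal terms; it is empty unless `y` and `z` agree on `F`.
  have hinner : ∀ y z : Ω,
      ∑ x, (if (∀ u ∈ insert v F, X y u = X x u) ∧ (∀ u ∈ G, X z u = X x u)
        then 1 / (cF x * cvG x) else 0) ≤
      if (∀ u ∈ F, X z u = X y u) then 1 / cF y else 0 := by
    intro y z
    rw [← Finset.sum_filter]
    set S := Finset.univ.filter fun x =>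
      (∀ u ∈ insert v F, X y u = X x u) ∧ (∀ u ∈ G, X z u = X x u) with hS
    rcases S.eq_empty_or_nonempty with h0 | ⟨x₀, hx₀⟩
    · rw [h0, Finset.sum_empty]
      have := pF y
      split_ifs <;> positivity
    have hx₀' := (Finset.mem_filter.1 hx₀).2
    have hyz : ∀ u ∈ F, X z u = X y u := fun u hu => by
      rw [hx₀'.1 u (Finset.mem_insert_of_mem hu), hx₀'.2 u (hFG hu)]
    rw [if_pos hyz]
    have hval : ∀ x ∈ S, 1 / (cF x * cvG x) = 1 / (cF y * cvG x₀) := by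
      intro x hx
      have hx' := (Finset.mem_filter.1 hx).2
      have e1 : cF x = cF y := by
        refine congrArg Nat.cast (classCard_congr X F fun u hu => ?_)
        rw [hx'.1 u (Finset.mem_insert_of_mem hu)]
      have e2 : cvG x = cvG x₀ := by
        refine congrArg Nat.cast (classCard_congr X _ fun u hu => ?_)
        rcases Finset.mem_insert.1 hu with rfl | hu
        · rw [← hx'.1 u (Finset.mem_insert_self _ _), hx₀'.1 u (Finset.mem_insert_self _ _)]
        · rw [← hx'.2 u hu, hx₀'.2 u hu]
      rw [e1, e2]
    rw [Finset.sum_congr rfl hval, Finset.sum_const, nsmul_eq_mul]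
    have hcard : (S.card : ℝ) ≤ cvG x₀ := by
      refine Nat.cast_le.2 (Finset.card_le_card fun x hx => ?_)
      have hx' := (Finset.mem_filter.1 hx).2
      refine Finset.mem_filter.2 ⟨Finset.mem_univ _, fun u hu => ?_⟩
      rcases Finset.mem_insert.1 hu with rfl | hu
      · rw [← hx'.1 u (Finset.mem_insert_self _ _), hx₀'.1 u (Finset.mem_insert_self _ _)]
      · rw [← hx'.2 u hu, hx₀'.2 u hu]
    have p1 := pF y
    have p2 := pvG x₀
    calc (S.card : ℝ) * (1 / (cF y * cvG x₀)) ≤ cvG x₀ * (1 / (cF y * cvG x₀)) := by gcongr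
      _ = 1 / cF y := by field_simp
  -- Writing the numerator as a number of pairs `(y, z)` and summing over `x` first reduces the
  -- bound to `hinner`; the resulting weights `1 / cF y` add up to 1 over the class of `y`.
  have hratio : ∑ x, cvF x * cG x / (cF x * cvG x) ≤ Fintype.card Ω := by
    have hexp : ∀ x, cvF x * cG x / (cF x * cvG x) = ∑ y, ∑ z,
        (if (∀ u ∈ insert v F, X y u = X x u) ∧ (∀ u ∈ G, X z u = X x u)
        then 1 / (cF x * cvG x) else 0) := by
      intro x
      have e1 : cvF x = ∑ y, if (∀ u ∈ insert v F, X y u = X x u) then (1 : ℝ) else 0 := by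
        simp only [cvF, classCard]
        rw [Finset.card_filter]
        push_cast
        rfl
      have e2 : cG x = ∑ z, if (∀ u ∈ G, X z u = X x u) then (1 : ℝ) else 0 := by
        simp only [cG, classCard]
        rw [Finset.card_filter]
        push_cast
        rfl
      rw [e1, e2, Finset.sum_mul_sum, Finset.sum_div]
      refine Finset.sum_congr rfl fun y _ => ?_
      rw [Finset.sum_div]
      refine Finset.sum_congr rfl fun z _ => ?_
      split_ifs <;> simp_all
    calc ∑ x, cvF x * cG x / (cF x * cvG x)
        = ∑ x, ∑ y, ∑ z, (if (∀ u ∈ insert v F, X y u = X x u) ∧ (∀ u ∈ G, X z u = X x u)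
        then 1 / (cF x * cvG x) else 0) := Finset.sum_congr rfl fun x _ => hexp x
      _ = ∑ y, ∑ z, ∑ x, (if (∀ u ∈ insert v F, X y u = X x u) ∧ (∀ u ∈ G, X z u = X x u)
        then 1 / (cF x * cvG x) else 0) := by
          rw [Finset.sum_comm]
          exact Finset.sum_congr rfl fun y _ => Finset.sum_comm
      _ ≤ ∑ y, ∑ z, if (∀ u ∈ F, X z u = X y u) then 1 / cF y else 0 :=
          Finset.sum_le_sum fun y _ => Finset.sum_le_sum fun z _ => hinner y z
      _ = ∑ _y : Ω, 1 := by
          refine Finset.sum_congr rfl fun y _ => ?_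
          rw [← Finset.sum_filter, Finset.sum_const, nsmul_eq_mul]
          have := (pF y).ne'
          change cF y * (1 / cF y) = 1
          field_simp
      _ = Fintype.card Ω := by simp
  have hterm : ∀ x, Real.logb 2 (cvF x) + Real.logb 2 (cG x) - Real.logb 2 (cF x) -
      Real.logb 2 (cvG x) ≤ (cvF x * cG x / (cF x * cvG x) - 1) / Real.log 2 := by
    intro x
    have h1 := Real.log_le_sub_one_of_pos
      (div_pos (mul_pos (pvF x) (pG x)) (mul_pos (pF x) (pvG x)))
    rw [Real.log_div (mul_pos (pvF x) (pG x)).ne' (mul_pos (pF x) (pvG x)).ne',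
      Real.log_mul (pvF x).ne' (pG x).ne', Real.log_mul (pF x).ne' (pvG x).ne'] at h1
    simp only [Real.logb, ← add_div, ← sub_div]
    rw [div_le_div_iff_of_pos_right hlog]
    linarith
  have hsum := Finset.sum_le_sum fun x (_ : x ∈ Finset.univ) => hterm x
  rw [← Finset.sum_div, Finset.sum_sub_distrib] at hsum
  simp only [Finset.sum_sub_distrib, Finset.sum_add_distrib] at hsum
  have h0 : (∑ x, cvF x * cG x / (cF x * cvG x) - ∑ _x : Ω, (1 : ℝ)) / Real.log 2 ≤ 0 := by
    refine div_nonpos_of_nonpos_of_nonneg ?_ hlog.le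
    simp only [Finset.sum_const, nsmul_eq_mul, mul_one, Finset.card_univ]
    linarith
  simp only [condEntropy, sumLogClass]
  change ∑ x, Real.logb 2 (cG x) - ∑ x, Real.logb 2 (cvG x) ≤
    ∑ x, Real.logb 2 (cF x) - ∑ x, Real.logb 2 (cvF x)
  linarith

/-- Subadditivity: by the chain rule the points of `G` are revealed one at a time, and discarding
the earlier ones from the conditioning only raises each term. -/
theorem sumLogClass_sub_le (G : Finset V) :
    sumLogClass X F - sumLogClass X (F ∪ G) ≤ ∑ v ∈ G, condEntropy X F v := by
  induction G using Finset.induction_on with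
  | empty => simp
  | insert v G hv ih =>
    rw [Finset.sum_insert hv, Finset.union_insert]
    have h := condEntropy_anti X (Finset.subset_union_left (s₁ := F) (s₂ := G)) v
    rw [condEntropy] at h
    linarith

/-- The entropy of the whole sample is that of `X_F`, at most `log |A|` per point, plus the entropy
given `X_F`. Injectivity leaves nothing uncertain once all coordinates are known. -/
theorem card_mul_logb_card_le (hX : Function.Injective X) :
    Fintype.card Ω * Real.logb 2 (Fintype.card Ω) ≤
      F.card * (Fintype.card Ω * Real.logb 2 (Fintype.card A)) + ∑ v, condEntropy X F v := by
  have h1 := sumLogClass_sub_le X ∅ F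
  have h2 := sumLogClass_sub_le X F Finset.univ
  have h3 : ∑ v ∈ F, condEntropy X ∅ v ≤
      F.card * (Fintype.card Ω * Real.logb 2 (Fintype.card A)) := by
    rw [← nsmul_eq_mul]
    exact Finset.sum_le_card_nsmul _ _ _ fun v _ => condEntropy_le X ∅ v
  have h4 : sumLogClass X ∅ = Fintype.card Ω * Real.logb 2 (Fintype.card Ω) := by
    simp [sumLogClass, classCard]
  have h5 : sumLogClass X Finset.univ = 0 := by
    refine Finset.sum_eq_zero fun x _ => ?_
    have : classCard X Finset.univ x = 1 := by
      refine Finset.card_eq_one.2 ⟨x, ?_⟩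
      ext y
      simp only [Finset.mem_filter, Finset.mem_univ, true_and, true_imp_iff,
        Finset.mem_singleton]
      exact ⟨fun h => hX (funext h), fun h => by simp [h]⟩
    simp [this]
  rw [Finset.empty_union] at h1
  rw [Finset.union_eq_right.2 (Finset.subset_univ F)] at h2
  linarith

/-- The chain rule in reverse order: when `φ j` is revealed, only later points of the window are
known, and conditioning on the possibly larger `T j` lowers the entropy. -/
theorem sum_condEntropy_le (k : ℕ) (φ : ℕ → V) (T : ℕ → Finset V)
    (hT : ∀ j j', j < j' → j' < k → φ j' ∈ T j) :
    ∑ j ∈ Finset.range k, condEntropy X (F ∪ T j) (φ j) ≤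
      sumLogClass X F - sumLogClass X (F ∪ (Finset.range k).image φ) := by
  set G : ℕ → Finset V := fun j => F ∪ (Finset.Ico j k).image φ with hG
  have h1 : ∀ j ∈ Finset.range k, condEntropy X (F ∪ T j) (φ j) ≤
      sumLogClass X (G (j + 1)) - sumLogClass X (G j) := by
    intro j hj
    have hins : G j = insert (φ j) (G (j + 1)) := by
      simp only [hG]
      rw [← Finset.insert_Ico_add_one_left_eq_Ico (Finset.mem_range.1 hj), Finset.image_insert,
        Finset.union_insert]
    rw [hins]
    refine condEntropy_anti X (Finset.union_subset_union le_rfl fun v hv => ?_) _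
    obtain ⟨j', hj', rfl⟩ := Finset.mem_image.1 hv
    exact hT j j' (Finset.mem_Ico.1 hj').1 (Finset.mem_Ico.1 hj').2
  refine (Finset.sum_le_sum h1).trans ?_
  rw [Finset.sum_range_sub fun j => sumLogClass X (G j)]
  simp [hG]

/-- The conditional total correlation of a window is the sum of the divergences of its conditional
laws from the products of their marginals. -/
theorem sum_divergence_eq {k : ℕ} (φ : ℕ → V) :
    ∑ x, ∑ a : Fin k → A, condDist X F (fun y (j : Fin k) => X y (φ j)) x a *
      (Real.logb 2 (condDist X F (fun y (j : Fin k) => X y (φ j)) x a) -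
        Real.logb 2 (productMeasure (fun j : Fin k => condDist X F (fun y => X y (φ j)) x) a)) =
    ∑ j ∈ Finset.range k, condEntropy X F (φ j) -
      (sumLogClass X F - sumLogClass X (F ∪ (Finset.range k).image φ)) := by
  rw [sum_sum_condDist_mul X F (fun y (j : Fin k) => X y (φ j)) fun x a =>
    (Real.logb 2 (condDist X F (fun y (j : Fin k) => X y (φ j)) x a) -
        Real.logb 2 (productMeasure (fun j : Fin k => condDist X F (fun y => X y (φ j)) x) a))]
  swap
  · intro x y h
    funext a
    rw [condDist_congr X F _ h]
    congr 3
    funext j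
    rw [condDist_congr X F _ h]
  have h1 : ∀ x, Real.logb 2 (condDist X F (fun y (j : Fin k) => X y (φ j)) x
      fun j => X x (φ j)) = Real.logb 2 (classCard X (F ∪ (Finset.range k).image φ) x) -
        Real.logb 2 (classCard X F x) := by
    intro x
    have h1 : condDist X F (fun y (j : Fin k) => X y (φ j)) x (fun j => X x (φ j)) =
        classCard X (F ∪ (Finset.range k).image φ) x / classCard X F x := by
      unfold condDist
      congr 2
      unfold classCard
      congr 1
      refine Finset.filter_congr fun y _ => ?_
      simp only [Finset.mem_union, Finset.mem_image, Finset.mem_range, funext_iff]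
      constructor
      · rintro ⟨h1, h2⟩ v (hv | ⟨j, hj, rfl⟩)
        · exact h1 v hv
        · exact h2 ⟨j, hj⟩
      · exact fun h => ⟨fun v hv => h v (Or.inl hv), fun j => h _ (Or.inr ⟨j, j.2, rfl⟩)⟩
    have h2 := classCard_pos X F x
    have h3 := classCard_pos X (F ∪ (Finset.range k).image φ) x
    rw [h1, Real.logb_div (by positivity) (by positivity)]
  have h2 : ∀ x, Real.logb 2 (productMeasure (fun j : Fin k =>
      condDist X F (fun y => X y (φ j)) x) fun j => X x (φ j)) = ∑ j ∈ Finset.range k,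
        (Real.logb 2 (classCard X (insert (φ j) F) x) - Real.logb 2 (classCard X F x)) := by
    intro x
    have h0 : ∀ j ∈ (Finset.univ : Finset (Fin k)),
        condDist X F (fun y => X y (φ j)) x (X x (φ j)) ≠ 0 :=
      fun j _ => (condDist_self_pos X F (fun y => X y (φ j)) x).ne'
    rw [Finset.sum_range]
    simp only [productMeasure, ← logb_condDist_apply]
    simp only [Real.logb, ← Finset.sum_div]
    rw [Real.log_prod h0]
  simp only [h1, h2, condEntropy, sumLogClass, Finset.sum_sub_distrib]
  rw [Finset.sum_comm (s := Finset.univ) (t := Finset.range k),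
    Finset.sum_comm (s := Finset.univ) (t := Finset.range k)]
  ring

/-- The absolute continuity required by Pinsker's inequality: a sample point realising `a` realises
each of its letters. -/
theorem productMeasure_condDist_ne_zero {k : ℕ} (φ : Fin k → V) (x : Ω) (a : Fin k → A)
    (h : condDist X F (fun y j => X y (φ j)) x a ≠ 0) :
    productMeasure (fun j => condDist X F (fun y => X y (φ j)) x) a ≠ 0 := by
  unfold condDist at h
  rw [div_ne_zero_iff, Nat.cast_ne_zero, Finset.card_ne_zero] at h
  obtain ⟨⟨y, hy⟩, -⟩ := h
  obtain ⟨h1, h2⟩ := (Finset.mem_filter.1 hy).2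
  subst h2
  refine Finset.prod_ne_zero_iff.2 fun j _ => ?_
  beta_reduce
  rw [← condDist_congr X F (fun y => X y (φ j)) h1]
  exact (condDist_self_pos X F (fun y => X y (φ j)) y).ne'

end ConditionalEntropy

/-! ### Random sets of density `1/(m+1)`, as colour classes of uniform colourings -/

section RandomSets

variable {V : Type*} [Fintype V] [DecidableEq V] {m : ℕ}

/-- The points of colour `0`. -/
def zeroSet (c : V → Fin (m + 1)) : Finset V := Finset.univ.filter fun v => c v = 0

theorem zeroSet_update (c : V → Fin (m + 1)) (t : V) :
    zeroSet (Function.update c t 0) = insert t (zeroSet c) := by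
  ext v
  by_cases h : v = t
  · simp [zeroSet, h]
  · simp [zeroSet, h]

/-- Exchanging the colour at `t` with the spare colour `b` is an involution on pairs, so resampling
one colour preserves the uniform law. -/
theorem sum_sum_update (t : V) (H : (V → Fin (m + 1)) → ℝ) :
    ∑ c, ∑ b, H (Function.update c t b) = (m + 1 : ℕ) * ∑ c, H c := by
  let e : (V → Fin (m + 1)) × Fin (m + 1) → (V → Fin (m + 1)) × Fin (m + 1) :=
    fun p => (Function.update p.1 t p.2, p.1 t)
  have he : Function.Involutive e := fun p => by simp [e]
  rw [← Fintype.sum_prod_type' fun c b => H (Function.update c t b),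
    ← Equiv.sum_comp he.toPerm fun p => H (Function.update p.1 t p.2)]
  simp only [Function.Involutive.coe_toPerm, e, Function.update_idem, Function.update_eq_self]
  rw [Fintype.sum_prod_type]
  simp [Finset.mul_sum]

theorem sum_insert_zeroSet (t : V) (g : Finset V → ℝ) :
    ∑ c : V → Fin (m + 1), g (insert t (zeroSet c)) =
      (m + 1 : ℕ) * ∑ c : V → Fin (m + 1), if t ∈ zeroSet c then g (zeroSet c) else 0 := by
  rw [← sum_sum_update t fun c => if t ∈ zeroSet c then g (zeroSet c) else 0]
  refine Finset.sum_congr rfl fun c _ => ?_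
  rw [Finset.sum_eq_single 0]
  · simp [zeroSet_update]
  · intro b _ hb
    simp [zeroSet, hb]
  · simp

/-- A change of measure: the law of `zeroSet c ∪ T` is the law of `zeroSet c` conditioned on
containing `T`, with density `(m+1)^|T|` on that event. -/
theorem sum_zeroSet_union (T : Finset V) (g : Finset V → ℝ) :
    ∑ c : V → Fin (m + 1), g (zeroSet c ∪ T) = ((m + 1 : ℕ) : ℝ) ^ T.card *
      ∑ c : V → Fin (m + 1), if T ⊆ zeroSet c then g (zeroSet c) else 0 := by
  induction T using Finset.induction_on generalizing g with
  | empty => simp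
  | insert t T ht ih =>
    simp only [Finset.union_insert]
    rw [ih fun S => g (insert t S)]
    have h1 : ∀ c : V → Fin (m + 1), T ⊆ zeroSet c ↔ T ⊆ insert t (zeroSet c) := fun c =>
      (Finset.subset_insert_iff_of_notMem ht).symm
    simp only [h1]
    rw [sum_insert_zeroSet t fun S => if T ⊆ S then g S else 0, Finset.card_insert_of_notMem ht,
      pow_succ, mul_assoc]
    simp only [Finset.insert_subset_iff, ite_and]

theorem sum_subset_zeroSet (T : Finset V) :
    ∑ c : V → Fin (m + 1), (((m + 1 : ℕ) : ℝ) ^ T.card * if T ⊆ zeroSet c then 1 else 0) =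
      Fintype.card (V → Fin (m + 1)) := by
  rw [← Finset.mul_sum, ← sum_zeroSet_union T fun _ => 1]
  simp

theorem sum_card_zeroSet :
    ∑ c : V → Fin (m + 1), ((zeroSet c).card : ℝ) =
      Fintype.card (V → Fin (m + 1)) * Fintype.card V / (m + 1 : ℕ) := by
  have h0 : ((m + 1 : ℕ) : ℝ) ≠ 0 := by positivity
  have h1 : ∀ t : V, ∑ c : V → Fin (m + 1), (if t ∈ zeroSet c then (1 : ℝ) else 0) =
      Fintype.card (V → Fin (m + 1)) / (m + 1 : ℕ) := by
    intro t
    rw [eq_div_iff h0, mul_comm, ← sum_insert_zeroSet t fun _ => 1]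
    simp
  have h2 : ∀ c : V → Fin (m + 1), ((zeroSet c).card : ℝ) =
      ∑ t, if t ∈ zeroSet c then (1 : ℝ) else 0 := by
    intro c
    simp
  simp only [h2]
  rw [Finset.sum_comm]
  simp only [h1, Finset.sum_const, nsmul_eq_mul, Finset.card_univ]
  ring

/-- A variance bound for the summed densities: containing disjoint sets are independent events, so
only the `d` diagonal terms survive. -/
theorem sum_sq_sum_subset_zeroSet_le {d r : ℕ} (T : Fin d → Finset V) (hT : ∀ i, (T i).card = r)
    (hdisj : ∀ i j, i ≠ j → Disjoint (T i) (T j)) :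
    ∑ c : V → Fin (m + 1),
      (∑ i, (((m + 1 : ℕ) : ℝ) ^ r * (if T i ⊆ zeroSet c then 1 else 0) - 1)) ^ 2 ≤
      Fintype.card (V → Fin (m + 1)) * (d * ((m + 1 : ℕ) : ℝ) ^ r) := by
  set N : ℝ := (Fintype.card (V → Fin (m + 1)) : ℝ)
  set Y : Fin d → (V → Fin (m + 1)) → ℝ :=
    fun i c => ((m + 1 : ℕ) : ℝ) ^ r * (if T i ⊆ zeroSet c then 1 else 0) with hY
  have hone : ∀ i, ∑ c, Y i c = N := fun i => by
    have := sum_subset_zeroSet (m := m) (T i)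
    rw [hT] at this
    exact this
  have htwo : ∀ i j, i ≠ j → ∑ c, Y i c * Y j c = N := fun i j hij => by
    have := sum_subset_zeroSet (m := m) (T i ∪ T j)
    rw [Finset.card_union_of_disjoint (hdisj i j hij), hT, hT] at this
    refine Eq.trans (Finset.sum_congr rfl fun c _ => ?_) this
    simp only [hY, Finset.union_subset_iff, ite_and]
    split_ifs <;> ring
  have hself : ∀ i, ∑ c, Y i c * Y i c = ((m + 1 : ℕ) : ℝ) ^ r * N := fun i => by
    rw [← hone i, Finset.mul_sum]
    refine Finset.sum_congr rfl fun c _ => ?_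
    simp only [hY]
    split_ifs <;> ring
  have hN : ∑ _c : V → Fin (m + 1), (1 : ℝ) = N := by simp [N]
  have hcov : ∀ i j, ∑ c, (Y i c - 1) * (Y j c - 1) ≤
      if i = j then ((m + 1 : ℕ) : ℝ) ^ r * N else 0 := by
    intro i j
    have : ∑ c, (Y i c - 1) * (Y j c - 1) = ∑ c, Y i c * Y j c - N := by
      calc ∑ c, (Y i c - 1) * (Y j c - 1) = ∑ c, (Y i c * Y j c - Y i c - Y j c + 1) :=
            Finset.sum_congr rfl fun c _ => by ring
        _ = _ := by
          rw [Finset.sum_add_distrib, Finset.sum_sub_distrib, Finset.sum_sub_distrib, hone, hone,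
            hN]
          ring
    rw [this]
    split_ifs with h
    · subst h
      rw [hself]
      have : 0 ≤ N := Nat.cast_nonneg _
      linarith
    · rw [htwo i j h, sub_self]
  calc ∑ c, (∑ i, (Y i c - 1)) ^ 2 = ∑ i, ∑ j, ∑ c, (Y i c - 1) * (Y j c - 1) := by
        simp only [sq, Finset.sum_mul_sum]
        rw [Finset.sum_comm]
        exact Finset.sum_congr rfl fun i _ => Finset.sum_comm
    _ ≤ ∑ i, ∑ j, if i = j then ((m + 1 : ℕ) : ℝ) ^ r * N else 0 :=
        Finset.sum_le_sum fun i _ => Finset.sum_le_sum fun j _ => hcov i j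
    _ = N * (d * ((m + 1 : ℕ) : ℝ) ^ r) := by
        simp only [Finset.sum_ite_eq, Finset.mem_univ, if_true, Finset.sum_const, nsmul_eq_mul,
          Finset.card_univ, Fintype.card_fin]
        ring

/-- Adding one of many disjoint small sets to a random set hardly changes its law. -/
theorem sum_sum_sub_zeroSet_union_le {d r : ℕ} (T : Fin d → Finset V)
    (hT : ∀ i, (T i).card = r) (hdisj : ∀ i j, i ≠ j → Disjoint (T i) (T j)) (f : Finset V → ℝ)
    {B : ℝ} (hf0 : ∀ S, 0 ≤ f S) (hfB : ∀ S, f S ≤ B) :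
    ∑ c : V → Fin (m + 1), ∑ i, (f (zeroSet c) - f (zeroSet c ∪ T i)) ≤
      B * (Fintype.card (V → Fin (m + 1)) * √(d * ((m + 1 : ℕ) : ℝ) ^ r)) := by
  set N : ℝ := (Fintype.card (V → Fin (m + 1)) : ℝ) with hNdef
  have hN : 0 ≤ N := Nat.cast_nonneg _
  have hB : 0 ≤ B := (hf0 ∅).trans (hfB ∅)
  set Z : (V → Fin (m + 1)) → ℝ := fun c =>
    ∑ i, (((m + 1 : ℕ) : ℝ) ^ r * (if T i ⊆ zeroSet c then 1 else 0) - 1) with hZ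
  -- The change of measure moves the dependence on `T i` from `f` into the centred density `Z`; then
  -- only the mean of `|Z|` matters, which Cauchy–Schwarz bounds by the standard deviation.
  have h1 : ∑ c : V → Fin (m + 1), ∑ i, (f (zeroSet c) - f (zeroSet c ∪ T i)) =
      ∑ c, f (zeroSet c) * (-Z c) := by
    have : ∀ i, ∑ c : V → Fin (m + 1), f (zeroSet c ∪ T i) = ∑ c : V → Fin (m + 1),
        f (zeroSet c) * (((m + 1 : ℕ) : ℝ) ^ r * (if T i ⊆ zeroSet c then 1 else 0)) := by
      intro i
      rw [sum_zeroSet_union, hT, Finset.mul_sum]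
      refine Finset.sum_congr rfl fun c _ => ?_
      split_ifs <;> ring
    rw [Finset.sum_comm]
    simp only [Finset.sum_sub_distrib, this]
    simp only [← Finset.sum_sub_distrib]
    rw [Finset.sum_comm]
    refine Finset.sum_congr rfl fun c _ => ?_
    rw [hZ, ← Finset.sum_neg_distrib, Finset.mul_sum]
    exact Finset.sum_congr rfl fun i _ => by ring
  have h2 : (∑ c, |Z c|) ^ 2 ≤ (N * √(d * ((m + 1 : ℕ) : ℝ) ^ r)) ^ 2 := by
    calc (∑ c, |Z c|) ^ 2 ≤ (Finset.univ : Finset (V → Fin (m + 1))).card * ∑ c, |Z c| ^ 2 :=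
          sq_sum_le_card_mul_sum_sq
      _ ≤ N * (N * (d * ((m + 1 : ℕ) : ℝ) ^ r)) := by
          simp only [sq_abs, Finset.card_univ]
          gcongr
          exact sum_sq_sum_subset_zeroSet_le T hT hdisj
      _ = (N * √(d * ((m + 1 : ℕ) : ℝ) ^ r)) ^ 2 := by
          rw [mul_pow, Real.sq_sqrt (by positivity)]
          ring
  have h3 := abs_le_of_sq_le_sq' h2 (by positivity) |>.2
  rw [h1]
  calc ∑ c, f (zeroSet c) * (-Z c) ≤ ∑ c, B * |Z c| := by
        refine Finset.sum_le_sum fun c _ => ?_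
        calc f (zeroSet c) * (-Z c) ≤ f (zeroSet c) * |Z c| :=
              mul_le_mul_of_nonneg_left (neg_le_abs _) (hf0 _)
          _ ≤ B * |Z c| := by gcongr; exact hfB _
    _ = B * ∑ c, |Z c| := by rw [Finset.mul_sum]
    _ ≤ _ := by gcongr

end RandomSets

/-! ### Windows along the axes and their total correlation -/

section Segments

variable {d n : ℕ}

/-- The point `v + j e_i`. -/
def axisPoint (i : Fin d) (v : Cube d n) (j : ℕ) : Cube d n := cyclicAdd v (Pi.single i (j : ℤ))

theorem axisPoint_axisPoint (i : Fin d) (v : Cube d n) (j l : ℕ) :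
    axisPoint i (axisPoint i v j) l = axisPoint i v (j + l) := by
  simp only [axisPoint, cyclicAdd_cyclicAdd, ← Pi.single_add]
  push_cast
  rfl

/-- Displacements below `n` are determined by their residues, and different axes alter different
coordinates, so two axes through `v` share only `v`. -/
theorem axisPoint_eq_axisPoint (v : Cube d n) {i i' : Fin d} {j j' : ℕ} (hj : j < n)
    (hj' : j' < n) (h : axisPoint i v j = axisPoint i' v j') : j = j' ∧ (i = i' ∨ j = 0) := by
  rw [axisPoint, axisPoint, cyclicAdd_eq_cyclicAdd_iff] at h
  have hmod : ∀ a b : ℕ, a < n → b < n → (a : ℤ) ≡ b [ZMOD n] → a = b := by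
    intro a b ha hb hab
    exact Nat.ModEq.eq_of_lt_of_lt ((Int.natCast_modEq_iff).1 hab) ha hb
  have h1 := (Int.ModEq.add_left_cancel' _ (h i))
  rw [Pi.single_eq_same] at h1
  by_cases hi : i = i'
  · subst hi
    rw [Pi.single_eq_same] at h1
    exact ⟨hmod _ _ hj hj' h1, Or.inl rfl⟩
  · rw [Pi.single_eq_of_ne hi] at h1
    have h2 := (Int.ModEq.add_left_cancel' _ (h i'))
    rw [Pi.single_eq_same, Pi.single_eq_of_ne (Ne.symm hi)] at h2
    have e1 := hmod j 0 hj (by omega) h1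
    have e2 := hmod 0 j' (by omega) hj' h2
    omega

/-- The points `v + e_i, …, v + (k-1) e_i`. -/
def axisTail (k : ℕ) (i : Fin d) (v : Cube d n) : Finset (Cube d n) :=
  (Finset.Ico 1 k).image (axisPoint i v)

theorem card_axisTail {k : ℕ} (hk : k ≤ n) (i : Fin d) (v : Cube d n) :
    (axisTail k i v).card = k - 1 := by
  rw [axisTail, Finset.card_image_of_injOn, Nat.card_Ico]
  intro j hj j' hj' h
  simp only [Finset.coe_Ico, Set.mem_Ico] at hj hj'
  exact (axisPoint_eq_axisPoint v (by omega) (by omega) h).1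

theorem disjoint_axisTail {k : ℕ} (hk : k ≤ n) {i i' : Fin d} (hi : i ≠ i') (v : Cube d n) :
    Disjoint (axisTail k i v) (axisTail k i' v) := by
  rw [Finset.disjoint_left]
  intro u hu hu'
  obtain ⟨j, hj, rfl⟩ := Finset.mem_image.1 hu
  obtain ⟨j', hj', h⟩ := Finset.mem_image.1 hu'
  rw [Finset.mem_Ico] at hj hj'
  rcases (axisPoint_eq_axisPoint v (by omega) (by omega) h).2 with h | h
  · exact hi h.symm
  · omega

theorem sum_axisPoint (i : Fin d) (j : ℕ) (f : Cube d n → ℝ) :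
    ∑ v, f (axisPoint i v j) = ∑ v, f v :=
  sum_cyclicAdd _ f

variable {Ω A : Type*} [Fintype Ω] [Fintype A] [DecidableEq A]

/-- The total correlation, conditional on `X_F` and summed over all `v`, of the coordinates
`v, v + e_i, …, v + (k-1) e_i`. -/
noncomputable def totalCorrelation (X : Ω → Cube d n → A) (k : ℕ) (F : Finset (Cube d n))
    (i : Fin d) : ℝ :=
  ∑ v, (∑ j ∈ Finset.range k, condEntropy X F (axisPoint i v j) -
    (sumLogClass X F - sumLogClass X (F ∪ (Finset.range k).image (axisPoint i v))))

/-- The tail of `v + j e_i` contains every later point of the window at `v`, so the reversed chain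
rule applies with tails. Translation then makes the `k` resulting sums over `v` equal. -/
theorem totalCorrelation_le (X : Ω → Cube d n → A) (k : ℕ) (F : Finset (Cube d n)) (i : Fin d) :
    totalCorrelation X k F i ≤
      k * ∑ v, (condEntropy X F v - condEntropy X (F ∪ axisTail k i v) v) := by
  have h1 : ∀ v : Cube d n, ∑ j ∈ Finset.range k,
      condEntropy X (F ∪ axisTail k i (axisPoint i v j)) (axisPoint i v j) ≤
      sumLogClass X F - sumLogClass X (F ∪ (Finset.range k).image (axisPoint i v)) := by
    intro v
    refine sum_condEntropy_le X F k (axisPoint i v) (fun j => axisTail k i (axisPoint i v j)) ?_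
    intro j j' hj hj'
    refine Finset.mem_image.2 ⟨j' - j, Finset.mem_Ico.2 (by omega), ?_⟩
    rw [axisPoint_axisPoint]
    congr 1
    omega
  calc totalCorrelation X k F i ≤ ∑ v : Cube d n, ∑ j ∈ Finset.range k,
        (condEntropy X F (axisPoint i v j) -
          condEntropy X (F ∪ axisTail k i (axisPoint i v j)) (axisPoint i v j)) := by
        refine Finset.sum_le_sum fun v _ => ?_
        rw [Finset.sum_sub_distrib]
        linarith [h1 v]
    _ = ∑ j ∈ Finset.range k, ∑ v : Cube d n, (condEntropy X F v -
          condEntropy X (F ∪ axisTail k i v) v) := by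
        rw [Finset.sum_comm]
        exact Finset.sum_congr rfl fun j _ => sum_axisPoint i j fun v => condEntropy X F v -
          condEntropy X (F ∪ axisTail k i v) v
    _ = _ := by simp [mul_sub]

/-- Some sparse set `F` makes the coordinates along some axis nearly independent given `X_F`. -/
theorem exists_card_add_totalCorrelation_le (X : Ω → Cube d n → A) {k : ℕ} (hk : k ≤ n)
    (hd : 0 < d) (m : ℕ) : ∃ (F : Finset (Cube d n)) (i : Fin d),
      F.card * (Fintype.card Ω * Real.logb 2 (Fintype.card A)) + totalCorrelation X k F i ≤
      Fintype.card (Cube d n) * (Fintype.card Ω * Real.logb 2 (Fintype.card A)) *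
        (1 / (m + 1 : ℕ) + k * √(d * ((m + 1 : ℕ) : ℝ) ^ (k - 1)) / d) := by
  set B := Fintype.card Ω * Real.logb 2 (Fintype.card A) with hB
  set N : ℝ := (Fintype.card (Cube d n → Fin (m + 1)) : ℝ) with hN
  set s := √(d * ((m + 1 : ℕ) : ℝ) ^ (k - 1)) with hs
  have hd' : (d : ℝ) ≠ 0 := by exact_mod_cast hd.ne'
  have hdisj : ∀ v : Cube d n, ∑ c : Cube d n → Fin (m + 1), ∑ i,
      (condEntropy X (zeroSet c) v - condEntropy X (zeroSet c ∪ axisTail k i v) v) ≤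
        B * (N * s) := fun v =>
    sum_sum_sub_zeroSet_union_le (fun i => axisTail k i v) (fun i => card_axisTail hk i v)
      (fun i j hij => disjoint_axisTail hk hij v) (fun F => condEntropy X F v)
      (fun F => condEntropy_nonneg X F v) (fun F => condEntropy_le X F v)
  have htot : ∑ c : Cube d n → Fin (m + 1), ∑ i, totalCorrelation X k (zeroSet c) i ≤
      k * (Fintype.card (Cube d n) * (B * (N * s))) := by
    calc ∑ c : Cube d n → Fin (m + 1), ∑ i, totalCorrelation X k (zeroSet c) i
        ≤ ∑ c : Cube d n → Fin (m + 1), ∑ i, k * ∑ v, (condEntropy X (zeroSet c) v -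
            condEntropy X (zeroSet c ∪ axisTail k i v) v) :=
          Finset.sum_le_sum fun c _ => Finset.sum_le_sum fun i _ => totalCorrelation_le X k _ i
      _ = k * ∑ v, ∑ c : Cube d n → Fin (m + 1), ∑ i, (condEntropy X (zeroSet c) v -
            condEntropy X (zeroSet c ∪ axisTail k i v) v) := by
          rw [Finset.sum_comm, Finset.mul_sum]
          simp only [← Finset.mul_sum]
          congr 1
          rw [Finset.sum_comm]
          refine (Finset.sum_congr rfl fun c _ => Finset.sum_comm).trans ?_
          exact Finset.sum_comm
      _ ≤ k * ∑ v : Cube d n, B * (N * s) := by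
          gcongr with v
          exact hdisj v
      _ = _ := by simp
  -- The cost of revealing and the total correlation are averaged together over colourings and axes,
  -- so that one choice controls both.
  obtain ⟨⟨c, i⟩, -, h⟩ := Finset.exists_le_of_sum_le
    (s := (Finset.univ : Finset ((Cube d n → Fin (m + 1)) × Fin d)))
    (f := fun p => (zeroSet p.1).card * B + totalCorrelation X k (zeroSet p.1) p.2)
    (g := fun _ => Fintype.card (Cube d n) * B * (1 / (m + 1 : ℕ) + k * s / d))
    ⟨(fun _ => 0, ⟨0, hd⟩), Finset.mem_univ _⟩ (by
      rw [Fintype.sum_prod_type]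
      simp only [Finset.sum_add_distrib, Finset.sum_const, nsmul_eq_mul, Finset.card_univ,
        Fintype.card_fin, ← Finset.mul_sum, ← Finset.sum_mul, Fintype.card_prod]
      rw [sum_card_zeroSet]
      push_cast at htot hN ⊢
      rw [← hN]
      have h0 : (m + 1 : ℝ) ≠ 0 := by positivity
      calc _ ≤ d * (N * Fintype.card (Cube d n) / (m + 1) * B) +
            k * (Fintype.card (Cube d n) * (B * (N * s))) := by
            gcongr
        _ = _ := by
            field_simp)
  exact ⟨zeroSet c, i, h⟩

/-- The density is made small first, by `m`; with `m` fixed, the other term decays like `1 / √d`. -/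
theorem exists_forall_density_le (k : ℕ) {η : ℝ} (hη : 0 < η) : ∃ m d₀ : ℕ, ∀ d : ℕ, d₀ ≤ d →
    0 < d ∧ 1 / ((m + 1 : ℕ) : ℝ) + k * √(d * ((m + 1 : ℕ) : ℝ) ^ (k - 1)) / d ≤ η := by
  obtain ⟨m, hm⟩ := exists_nat_one_div_lt (half_pos hη)
  set R := √(((m + 1 : ℕ) : ℝ) ^ (k - 1)) with hR
  have hlim : Tendsto (fun d : ℕ => k * R * √((d : ℝ)⁻¹)) atTop (𝓝 (k * R * √0)) :=
    ((Real.continuous_sqrt.tendsto 0).comp tendsto_inv_atTop_nhds_zero_nat).const_mul _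
  rw [Real.sqrt_zero, mul_zero] at hlim
  obtain ⟨d₀, hd₀⟩ := eventually_atTop.1 (hlim.eventually (gt_mem_nhds (half_pos hη)))
  refine ⟨m, max d₀ 1, fun d hd => ⟨by omega, ?_⟩⟩
  have hd1 : (0 : ℝ) < d := by exact_mod_cast (by omega : 0 < d)
  have h1 := hd₀ d (by omega)
  have h2 : k * √(d * ((m + 1 : ℕ) : ℝ) ^ (k - 1)) / d = k * R * √((d : ℝ)⁻¹) := by
    rw [Real.sqrt_mul hd1.le, Real.sqrt_inv, ← hR]
    have := Real.mul_self_sqrt hd1.le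
    have hs := (Real.sqrt_pos.2 hd1).ne'
    field_simp
    rw [sq, this]
    ring
  rw [h2]
  push_cast at hm ⊢
  linarith

end Segments

/-! ### Averages of measures -/

section Averages

variable {X Θ : Type*} [Fintype X] [Fintype Θ]

theorem tvDist_const_mul_sum_le {c : ℝ} (hc : 0 ≤ c) (μ ν : Θ → X → ℝ) :
    tvDist (fun x => c * ∑ θ, μ θ x) (fun x => c * ∑ θ, ν θ x) ≤
      c * ∑ θ, tvDist (μ θ) (ν θ) := by
  unfold tvDist
  rw [← Finset.mul_sum, Finset.sum_comm, mul_left_comm, Finset.mul_sum _ _ c]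
  refine mul_le_mul_of_nonneg_left (a := (1 / 2 : ℝ)) (Finset.sum_le_sum fun x _ => ?_) (by norm_num)
  rw [← mul_sub, ← Finset.sum_sub_distrib, abs_mul, abs_of_nonneg hc]
  gcongr
  exact Finset.abs_sum_le_sum_abs _ _

theorem tvDist_le_one {μ ν : X → ℝ} (hμ : μ ∈ stdSimplex ℝ X) (hν : ν ∈ stdSimplex ℝ X) :
    tvDist μ ν ≤ 1 := by
  unfold tvDist
  calc (1 / 2) * ∑ x, |μ x - ν x| ≤ (1 / 2) * ∑ x, (μ x + ν x) := by
        gcongr with x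
        rw [abs_le]
        constructor <;> linarith [hμ.1 x, hν.1 x]
    _ = 1 := by rw [Finset.sum_add_distrib, hμ.2, hν.2]; norm_num

theorem tvDist_self (μ : X → ℝ) : tvDist μ μ = 0 := by simp [tvDist]

theorem average_mem_stdSimplex {c : ℝ} (hc : c * Fintype.card Θ = 1) (hc0 : 0 ≤ c) {μ : Θ → X → ℝ}
    (hμ : ∀ θ, μ θ ∈ stdSimplex ℝ X) : (fun x => c * ∑ θ, μ θ x) ∈ stdSimplex ℝ X := by
  refine ⟨fun x => mul_nonneg hc0 (Finset.sum_nonneg fun θ _ => (hμ θ).1 x), ?_⟩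
  rw [← Finset.mul_sum, Finset.sum_comm]
  simp [(hμ _).2, hc]

/-- This is where convexity of `Γ` enters the proof. -/
theorem average_mem_of_convex {c : ℝ} (hc : c * Fintype.card Θ = 1) (hc0 : 0 ≤ c)
    {Γ : Set (X → ℝ)} (hΓ : Convex ℝ Γ) {μ : Θ → X → ℝ} (hμ : ∀ θ, μ θ ∈ Γ) :
    (fun x => c * ∑ θ, μ θ x) ∈ Γ := by
  have h := hΓ.sum_mem (t := Finset.univ) (w := fun _ : Θ => c) (z := μ) (fun _ _ => hc0)
    (by simpa [mul_comm] using hc) (fun θ _ => hμ θ)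
  convert h using 1
  funext x
  simp [Finset.sum_apply, Finset.mul_sum]

variable {A : Type*} [Fintype A] [DecidableEq A] {d n : ℕ} {ι : Type*} [Fintype ι] [DecidableEq ι]

theorem averageMarginal_mem_stdSimplex (p : ι → Fin d → ℤ) (hn : 0 < n)
    {μ : (Cube d n → A) → ℝ} (hμ : μ ∈ stdSimplex ℝ (Cube d n → A)) :
    averageMarginal p μ ∈ stdSimplex ℝ (ι → A) := by
  refine average_mem_stdSimplex ?_ (by positivity) fun v => pushforward_mem_stdSimplex _ hμ
  rw [card_cube]
  have : (n : ℝ) ≠ 0 := by exact_mod_cast hn.ne'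
  field_simp

end Averages

/-! ### One-dimensional product measures by concatenation -/

section Concatenation

variable {A Θ : Type*} [Fintype A] [DecidableEq A] [Fintype Θ]

/-- Positions in a concatenation of words of length `l` indexed by `Θ`. -/
noncomputable def concatEquiv (Θ : Type*) [Fintype Θ] (l : ℕ) :
    Θ × Fin l ≃ Cube 1 (Fintype.card Θ * l) :=
  ((Equiv.prodCongr (Fintype.equivFin Θ) (Equiv.refl (Fin l))).trans finProdFinEquiv).trans
    (Equiv.funUnique (Fin 1) (Fin (Fintype.card Θ * l))).symm

theorem concatEquiv_val (l : ℕ) (θ : Θ) (t : Fin l) (i : Fin 1) :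
    (concatEquiv Θ l (θ, t) i : ℕ) = t + l * Fintype.equivFin Θ θ := by
  simp [concatEquiv]

theorem cyclicAdd_concatEquiv {l : ℕ} {k : ℕ} (θ : Θ) (t : Fin l) (j : Fin k)
    (h : (t : ℕ) + j < l) :
    cyclicAdd (concatEquiv Θ l (θ, t)) (segment k j) = concatEquiv Θ l (θ, ⟨t + j, h⟩) := by
  refine cube_ext fun i => ?_
  have hlt := (concatEquiv Θ l (θ, ⟨t + j, h⟩) i).isLt
  rw [concatEquiv_val] at hlt
  rw [cyclicAdd_apply, concatEquiv_val, concatEquiv_val, segment]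
  simp only at hlt ⊢
  rw [Int.emod_eq_of_lt (by positivity)]
  · push_cast
    ring
  · zify at hlt ⊢
    linarith

theorem card_filter_lt_add_le (l k : ℕ) :
    (Finset.univ.filter fun t : Fin l => l < t + k).card ≤ k := by
  have h1 : ((Finset.univ.filter fun t : Fin l => l < t + k).map Fin.valEmbedding) ⊆
      Finset.Ico (l - k) l := by
    intro x hx
    obtain ⟨t, ht, rfl⟩ := Finset.mem_map.1 hx
    have := (Finset.mem_filter.1 ht).2
    have := t.isLt
    simp only [Fin.valEmbedding_apply, Finset.mem_Ico]
    omega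
  have h2 := Finset.card_le_card h1
  rw [Finset.card_map, Nat.card_Ico] at h2
  omega

/-- The product measure on the concatenation of the words `q θ 0, …, q θ (l-1)`. -/
noncomputable def concat (q : Θ → ℕ → A → ℝ) (l : ℕ) (v : Cube 1 (Fintype.card Θ * l)) : A → ℝ :=
  q ((concatEquiv Θ l).symm v).1 ((concatEquiv Θ l).symm v).2

/-- A window inside one block has exactly the product law whose mean over `Θ` is `ρ`. At most `k`
windows per block of length `l` leave it, each at distance at most 1. -/
theorem tvDist_averageMarginal_concat_le [Nonempty Θ] {k l : ℕ} (hl : 0 < l) (q : Θ → ℕ → A → ℝ)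
    (hq : ∀ θ t, q θ t ∈ stdSimplex ℝ A) {ρ : (Fin k → A) → ℝ}
    (hρ : ∀ t a, ∑ θ, ∏ j : Fin k, q θ (t + j) (a j) = Fintype.card Θ * ρ a) :
    tvDist (averageMarginal (segment k) (productMeasure (concat q l))) ρ ≤ k / l := by
  have hM : (0 : ℝ) < Fintype.card Θ := by exact_mod_cast Fintype.card_pos
  have hl' : (0 : ℝ) < l := by exact_mod_cast hl
  set c : ℝ := 1 / ((Fintype.card Θ * l : ℕ) : ℝ) ^ 1 with hc
  have hc0 : 0 ≤ c := by positivity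
  have hQ : ∀ v, concat q l v ∈ stdSimplex ℝ A := fun v => hq _ _
  set R : Θ × Fin l → (Fin k → A) → ℝ := fun p =>
    pushforward (pattern (segment k) (concatEquiv Θ l p)) (productMeasure (concat q l)) with hR
  set S : Θ × Fin l → (Fin k → A) → ℝ := fun p =>
    productMeasure fun j : Fin k => q p.1 (p.2 + j) with hS
  have h1 : averageMarginal (segment k) (productMeasure (concat q l)) =
      fun a => c * ∑ p, R p a := by
    funext a
    rw [averageMarginal, ← Equiv.sum_comp (concatEquiv Θ l)]
  have h2 : ρ = fun a => c * ∑ p, S p a := by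
    funext a
    simp only [hS, productMeasure]
    rw [Fintype.sum_prod_type, Finset.sum_comm]
    simp only [hρ, Finset.sum_const, nsmul_eq_mul, Finset.card_univ, Fintype.card_fin, hc]
    push_cast
    field_simp
  have h3 : ∀ p : Θ × Fin l, tvDist (R p) (S p) ≤ if l < p.2 + k then 1 else 0 := by
    rintro ⟨θ, t⟩
    split_ifs with h
    · exact tvDist_le_one (pushforward_mem_stdSimplex _ (productMeasure_mem_stdSimplex hQ))
        (productMeasure_mem_stdSimplex fun _ => hq _ _)
    · have hlt : ∀ j : Fin k, (t : ℕ) + j < l := fun j => by have := j.isLt; simp only at h; omega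
      have : R (θ, t) = S (θ, t) := by
        have hφ : Function.Injective fun j : Fin k => concatEquiv Θ l (θ, ⟨t + j, hlt j⟩) := by
          intro j j' hj
          have := (concatEquiv Θ l).injective hj
          simp only [Prod.mk.injEq, Fin.mk.injEq, true_and, add_right_inj] at this
          exact Fin.ext this
        have hpush := pushforward_productMeasure hQ hφ
        simp only [hR, hS]
        have hpat : pattern (A := A) (segment k) (concatEquiv Θ l (θ, t)) =
            fun w j => w (concatEquiv Θ l (θ, ⟨t + j, hlt j⟩)) := by
          funext w j
          rw [pattern, cyclicAdd_concatEquiv θ t j (hlt j)]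
        rw [hpat, hpush]
        simp [concat]
      rw [this, tvDist_self]
  rw [h1, h2]
  calc _ ≤ c * ∑ p, tvDist (R p) (S p) := tvDist_const_mul_sum_le hc0 R S
    _ ≤ c * ∑ p : Θ × Fin l, if l < p.2 + k then 1 else 0 := by
        gcongr with p
        exact h3 p
    _ ≤ c * ∑ _θ : Θ, (k : ℝ) := by
        rw [Fintype.sum_prod_type]
        gcongr with θ
        rw [Finset.sum_boole]
        exact_mod_cast card_filter_lt_add_le l k
    _ = k / l := by
        simp only [Finset.sum_const, nsmul_eq_mul, Finset.card_univ, hc]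
        push_cast
        field_simp

theorem entropy_concat {l : ℕ} (q : Θ → ℕ → A → ℝ) (hq : ∀ θ t, q θ t ∈ stdSimplex ℝ A) :
    entropy (productMeasure (concat q l)) = ∑ t : Fin l, ∑ θ, entropy (q θ t) := by
  rw [entropy_productMeasure (q := concat q l) fun v => hq _ _, ← Equiv.sum_comp (concatEquiv Θ l),
    Fintype.sum_prod_type, Finset.sum_comm]
  simp [concat]

/-- Families of product measures whose mean law does not depend on the time are averaged by
concatenation. -/
theorem le_internalIndependenceEntropy [Nonempty Θ] {k : ℕ} (q : Θ → ℕ → A → ℝ)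
    (hq : ∀ θ t, q θ t ∈ stdSimplex ℝ A) {ρ : (Fin k → A) → ℝ}
    (hρ : ∀ t a, ∑ θ, ∏ j : Fin k, q θ (t + j) (a j) = Fintype.card Θ * ρ a) {h : ℝ}
    (hh : ∀ t, ∑ θ, entropy (q θ t) = Fintype.card Θ * h) {Γ : Set ((Fin k → A) → ℝ)} {ε : ℝ}
    {ν : (Fin k → A) → ℝ} (hν : ν ∈ Γ) (hε : tvDist ρ ν < ε) :
    (h : EReal) ≤ internalIndependenceEntropy (segment k) (ball ε Γ) := by
  have hM : (0 : ℝ) < Fintype.card Θ := by exact_mod_cast Fintype.card_pos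
  -- Only the lengths `Fintype.card Θ * l` are used, which suffices for a limsup; `l` is taken so
  -- large that `k / l` fits into the slack `ε - tvDist ρ ν`.
  refine le_limsup_of_frequently_le (frequently_atTop.2 fun N₀ => ?_)
  obtain ⟨l₀, hl₀⟩ := exists_nat_gt (k / (ε - tvDist ρ ν))
  set l := max (max l₀ N₀) 1 with hl
  have hlpos : 0 < l := by omega
  have hl' : (0 : ℝ) < l := by exact_mod_cast hlpos
  refine ⟨Fintype.card Θ * l, ?_, ?_⟩
  · calc N₀ ≤ 1 * l := by omega
      _ ≤ _ := Nat.mul_le_mul_right _ Fintype.card_pos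
  have hQ : ∀ v, concat q l v ∈ stdSimplex ℝ A := fun v => hq _ _
  have hmem : productMeasure (concat q l) ∈
      independentMeasures (segment k) (ball ε Γ) (Fintype.card Θ * l) := by
    refine ⟨⟨concat q l, hQ, rfl⟩, mem_ball_of_tvDist_le (averageMarginal_mem_stdSimplex _
      (Nat.mul_pos Fintype.card_pos hlpos) (productMeasure_mem_stdSimplex hQ)) hν ?_⟩
    have h1 := tvDist_averageMarginal_concat_le hlpos q hq hρ
    have h2 : (k : ℝ) / l ≤ ε - tvDist ρ ν := by
      have hpos : 0 < ε - tvDist ρ ν := by linarith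
      rw [div_lt_iff₀ hpos] at hl₀
      rw [div_le_iff₀ hl']
      have : (l₀ : ℝ) ≤ l := by exact_mod_cast (by omega : l₀ ≤ l)
      nlinarith
    have h3 := tvDist_triangle (averageMarginal (segment k) (productMeasure (concat q l))) ρ ν
    linarith
  refine le_iSup₂_of_le _ hmem (EReal.coe_le_coe_iff.2 (le_of_eq ?_))
  rw [entropy_concat q hq]
  simp only [hh, Finset.sum_const, nsmul_eq_mul, Finset.card_univ, Fintype.card_fin]
  push_cast
  field_simp

end Concatenation

/-! ### The upper bound on the capacity -/

section UpperBound

variable {A : Type*} [Fintype A] [DecidableEq A] {k d n : ℕ}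

theorem pushforward_axisRestrict_empirical (i : Fin d) (w : Cube d n → A) (a : Fin k → A) :
    pushforward (axisRestrict i) (empirical (axialWindow d k) w) a =
      1 / (n : ℝ) ^ d * ∑ v, if (fun j : Fin k => w (axisPoint i v j)) = a then 1 else 0 := by
  simp only [pushforward, empirical]
  rw [← Finset.mul_sum, Finset.sum_comm]
  congr 1
  refine Finset.sum_congr rfl fun v _ => ?_
  rw [Finset.sum_ite_eq]
  simp only [Finset.mem_filter, Finset.mem_univ, true_and]
  rfl

variable {Ω : Type*} [Fintype Ω] [Nonempty Ω]

/-- The total correlation is the summed divergence of the conditional window laws from the products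
of their marginals. Pinsker's inequality turns it into squared distances, and Cauchy–Schwarz over
samples and positions yields the square root. -/
theorem tvDist_average_condDist_le (X : Ω → Cube d n → A) (F : Finset (Cube d n)) (i : Fin d)
    (hn : 0 < n) {s : ℝ}
    (hs : totalCorrelation X k F i ≤ Fintype.card Ω * (n : ℝ) ^ d * s) :
    tvDist (fun a : Fin k → A => 1 / (Fintype.card Ω * (n : ℝ) ^ d) * ∑ p : Ω × Cube d n,
        ∏ j : Fin k, condDist X F (fun y => X y (axisPoint i p.2 j)) p.1 (a j))
      (fun a => 1 / (Fintype.card Ω : ℝ) * ∑ x,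
        pushforward (axisRestrict i) (empirical (axialWindow d k) (X x)) a) ≤ √s := by
  have hM : (0 : ℝ) < Fintype.card Ω := by exact_mod_cast Fintype.card_pos
  have hn' : (0 : ℝ) < n := by exact_mod_cast hn
  set K : ℝ := Fintype.card Ω * (n : ℝ) ^ d with hK
  have hKpos : 0 < K := by positivity
  set P : Ω × Cube d n → (Fin k → A) → ℝ := fun p =>
    condDist X F (fun y (j : Fin k) => X y (axisPoint i p.2 j)) p.1 with hP
  set Q : Ω × Cube d n → (Fin k → A) → ℝ := fun p =>
    productMeasure fun j : Fin k => condDist X F (fun y => X y (axisPoint i p.2 j)) p.1 with hQ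
  have h2 : (fun a => 1 / (Fintype.card Ω : ℝ) * ∑ x,
        pushforward (axisRestrict i) (empirical (axialWindow d k) (X x)) a) =
      fun a => 1 / K * ∑ p, P p a := by
    funext a
    -- By total expectation the conditional window laws average to the observed windows, so
    -- conditioning leaves the mean empirical distribution unchanged.
    have htower : ∀ v : Cube d n, ∑ x, P (x, v) a =
        ∑ x, if (fun j : Fin k => X x (axisPoint i v j)) = a then (1 : ℝ) else 0 := by
      intro v
      rw [← sum_sum_condDist_mul X F (fun y (j : Fin k) => X y (axisPoint i v j))
        (fun _ t => if t = a then 1 else 0) fun _ _ _ => rfl]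
      simp [hP]
    rw [Fintype.sum_prod_type, Finset.sum_comm]
    simp only [htower, pushforward_axisRestrict_empirical, ← Finset.mul_sum]
    rw [Finset.sum_comm, hK]
    field_simp
  have hPs : ∀ p, P p ∈ stdSimplex ℝ (Fin k → A) := fun p => condDist_mem_stdSimplex _ _ _ _
  have hQs : ∀ p, Q p ∈ stdSimplex ℝ (Fin k → A) := fun p =>
    productMeasure_mem_stdSimplex fun j => condDist_mem_stdSimplex _ _ _ _
  have hkl : ∑ p, (∑ a, |P p a - Q p a|) ^ 2 ≤ 4 * (K * s) := by
    calc ∑ p, (∑ a, |P p a - Q p a|) ^ 2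
        ≤ ∑ p, 4 * ∑ a, P p a * (Real.logb 2 (P p a) - Real.logb 2 (Q p a)) :=
          Finset.sum_le_sum fun p _ => sq_sum_abs_sub_le (hPs p) (hQs p) fun a =>
            productMeasure_condDist_ne_zero X F (fun j : Fin k => axisPoint i p.2 j) p.1 a
      _ = 4 * totalCorrelation X k F i := by
          rw [← Finset.mul_sum, Fintype.sum_prod_type, Finset.sum_comm, totalCorrelation]
          congr 1
          exact Finset.sum_congr rfl fun v _ => sum_divergence_eq X F (axisPoint i v)
      _ ≤ 4 * (K * s) := by gcongr
  have hs0 : 0 ≤ s := by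
    have : 0 ≤ 4 * (K * s) := le_trans (Finset.sum_nonneg fun p _ => sq_nonneg _) hkl
    by_contra hneg
    have := mul_neg_of_pos_of_neg hKpos (not_le.1 hneg)
    linarith
  have hcard : ((Finset.univ : Finset (Ω × Cube d n)).card : ℝ) = K := by
    rw [Finset.card_univ, Fintype.card_prod, Nat.cast_mul, card_cube]
  have hsum : ∑ p, ∑ a, |P p a - Q p a| ≤ 2 * K * √s := by
    refine abs_le_of_sq_le_sq' ?_ (by positivity) |>.2
    calc (∑ p, ∑ a, |P p a - Q p a|) ^ 2 ≤ K * ∑ p, (∑ a, |P p a - Q p a|) ^ 2 := by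
          rw [← hcard]
          exact sq_sum_le_card_mul_sum_sq
      _ ≤ K * (4 * (K * s)) := by gcongr
      _ = (2 * K * √s) ^ 2 := by
          rw [mul_pow, Real.sq_sqrt hs0]
          ring
  rw [h2, tvDist_comm]
  calc tvDist (fun a => 1 / K * ∑ p, P p a) (fun a => 1 / K * ∑ p, Q p a)
      ≤ 1 / K * ∑ p, tvDist (P p) (Q p) := tvDist_const_mul_sum_le (by positivity) P Q
    _ = 1 / K * (1 / 2 * ∑ p, ∑ a, |P p a - Q p a|) := by simp only [tvDist, ← Finset.mul_sum]
    _ ≤ 1 / K * (1 / 2 * (2 * K * √s)) := by gcongr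
    _ = √s := by field_simp

/-- The product measures are indexed by a sample `x` and a starting point `v`, with the conditional
law at `v + t e_i` given `X_F` as time-`t` law. Revealing `F` costs at most `log |A| * η` per site,
and non-independence displaces the window law by at most `√(log |A| * η)`. -/
theorem logb_card_div_le (X : Ω → Cube d n → A) (hX : Function.Injective X)
    {Γ : Set ((Fin k → A) → ℝ)} (hconv : Convex ℝ Γ) (hn : 0 < n) (hk : k ≤ n) {ε δ η : ℝ}
    (hd : 0 < d) {m : ℕ}
    (hm : 1 / ((m + 1 : ℕ) : ℝ) + k * √(d * ((m + 1 : ℕ) : ℝ) ^ (k - 1)) / d ≤ η)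
    (hXB : ∀ x, empirical (axialWindow d k) (X x) ∈ ball ε (axialProduct d Γ))
    (hδ : √(Real.logb 2 (Fintype.card A) * η) + ε < δ) :
    ((Real.logb 2 (Fintype.card Ω) / (n : ℝ) ^ d : ℝ) : EReal) ≤
      internalIndependenceEntropy (segment k) (ball δ Γ) +
        ((Real.logb 2 (Fintype.card A) * η : ℝ) : EReal) := by
  set lA := Real.logb 2 (Fintype.card A) with hlA
  have hlA0 : 0 ≤ lA := by
    rcases Nat.eq_zero_or_pos (Fintype.card A) with h | h
    · simp [hlA, h]
    · exact Real.logb_nonneg (by norm_num) (by exact_mod_cast h)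
  have hM : (0 : ℝ) < Fintype.card Ω := by exact_mod_cast Fintype.card_pos
  have hn' : (0 : ℝ) < n := by exact_mod_cast hn
  have hN : (0 : ℝ) < (n : ℝ) ^ d := by positivity
  obtain ⟨F, i, hF⟩ := exists_card_add_totalCorrelation_le X hk hd m
  rw [card_cube, ← hlA] at hF
  have hF' : F.card * (Fintype.card Ω * lA) + totalCorrelation X k F i ≤
      (n : ℝ) ^ d * (Fintype.card Ω * lA) * η := hF.trans (by gcongr)
  -- Both summands of `hF'` are nonnegative, so each separately obeys the bound: `hTC` drops the
  -- cost of `F`, and `hfin` drops the total correlation.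
  have hTC0 : 0 ≤ totalCorrelation X k F i := by
    refine Finset.sum_nonneg fun v _ => sub_nonneg.2 ?_
    have h1 := sumLogClass_sub_le X F ((Finset.range k).image (axisPoint i v))
    rw [Finset.sum_image] at h1
    · exact h1
    · intro j hj j' hj' h
      simp only [Finset.coe_range, Set.mem_Iio] at hj hj'
      exact (axisPoint_eq_axisPoint v (by omega) (by omega) h).1
  have hTC : totalCorrelation X k F i ≤ Fintype.card Ω * (n : ℝ) ^ d * (lA * η) := by
    have : 0 ≤ F.card * (Fintype.card Ω * lA) := by positivity
    linarith
  have : Nonempty (Cube d n) := ⟨fun _ => ⟨0, hn⟩⟩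
  have hcard : (Fintype.card (Ω × Cube d n) : ℝ) = Fintype.card Ω * (n : ℝ) ^ d := by
    rw [Fintype.card_prod, Nat.cast_mul, card_cube]
  choose μ hμ hμε using fun x => exists_tvDist_lt_of_mem_ball (hXB x)
    (show ε < δ - √(lA * η) by linarith)
  set ν : (Fin k → A) → ℝ := fun a => 1 / (Fintype.card Ω : ℝ) * ∑ x,
    pushforward (axisRestrict i) (μ x) a with hν
  have hνΓ : ν ∈ Γ := average_mem_of_convex (by field_simp) (by positivity) hconv
    fun x => (hμ x).2 i
  set q : Ω × Cube d n → ℕ → A → ℝ := fun p t =>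
    condDist X F (fun y => X y (axisPoint i p.2 t)) p.1 with hq
  set h : ℝ := 1 / (Fintype.card Ω * (n : ℝ) ^ d) * ∑ v, condEntropy X F v with hh
  have hlt : tvDist (fun a => 1 / (Fintype.card Ω : ℝ) * ∑ x,
      pushforward (axisRestrict i) (empirical (axialWindow d k) (X x)) a) ν < δ - √(lA * η) := by
    refine (tvDist_const_mul_sum_le (by positivity) _ _).trans_lt ?_
    calc _ < 1 / (Fintype.card Ω : ℝ) * ∑ _x : Ω, (δ - √(lA * η)) := by
          gcongr with x
          · exact Finset.univ_nonempty
          · exact (tvDist_pushforward_le _ _ _).trans_lt (hμε x)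
      _ = _ := by
          simp only [Finset.sum_const, nsmul_eq_mul, Finset.card_univ]
          field_simp
  have hI := le_internalIndependenceEntropy (k := k) q
    (fun p t => condDist_mem_stdSimplex X F _ _)
    (ρ := fun a => 1 / (Fintype.card Ω * (n : ℝ) ^ d) * ∑ p : Ω × Cube d n,
        ∏ j : Fin k, condDist X F (fun y => X y (axisPoint i p.2 j)) p.1 (a j))
    -- Advancing the time by `t` only permutes the starting points `v`, so the mean law is
    -- independent of `t`; the entropy condition below holds for the same reason.
    (fun t a => by
      rw [hcard, ← mul_assoc, mul_one_div_cancel (by positivity), one_mul,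
        Fintype.sum_prod_type, Fintype.sum_prod_type]
      refine Finset.sum_congr rfl fun x _ => ?_
      refine Eq.trans (Finset.sum_congr rfl fun v _ => ?_) (sum_axisPoint i t fun v =>
        ∏ j : Fin k, condDist X F (fun y => X y (axisPoint i v j)) x (a j))
      simp only [hq, axisPoint_axisPoint])
    (h := h)
    (fun t => by
      rw [hcard, hh, ← mul_assoc, mul_one_div_cancel (by positivity), one_mul,
        Fintype.sum_prod_type, Finset.sum_comm, ← sum_axisPoint i t fun v => condEntropy X F v]
      simp only [hq, sum_entropy_condDist_apply])
    hνΓ (ε := δ) (by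
      refine (tvDist_triangle _ _ _).trans_lt ((add_lt_add_of_le_of_lt
        (tvDist_average_condDist_le X F i hn hTC) hlt).trans_eq ?_)
      ring)
  have hfin : Real.logb 2 (Fintype.card Ω) / (n : ℝ) ^ d ≤ h + lA * η := by
    have h1 := card_mul_logb_card_le X F hX
    rw [← hlA] at h1
    have h2 : ∑ v, condEntropy X F v = Fintype.card Ω * (n : ℝ) ^ d * h := by
      rw [hh]
      field_simp
    rw [h2] at h1
    rw [div_le_iff₀ hN]
    refine le_of_mul_le_mul_left ?_ hM
    linarith
  calc ((Real.logb 2 (Fintype.card Ω) / (n : ℝ) ^ d : ℝ) : EReal) ≤ ((h + lA * η : ℝ) : EReal) :=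
        EReal.coe_le_coe_iff.2 hfin
    _ = (h : EReal) + ((lA * η : ℝ) : EReal) := EReal.coe_add _ _
    _ ≤ _ := by gcongr

theorem internalCapacity_axialProduct_le {Γ : Set ((Fin k → A) → ℝ)} (hconv : Convex ℝ Γ)
    {ε δ η : ℝ} (hd : 0 < d) {m : ℕ}
    (hm : 1 / ((m + 1 : ℕ) : ℝ) + k * √(d * ((m + 1 : ℕ) : ℝ) ^ (k - 1)) / d ≤ η)
    (hδ : √(Real.logb 2 (Fintype.card A) * η) + ε < δ) :
    internalCapacity (axialWindow d k) (ball ε (axialProduct d Γ)) ≤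
      internalIndependenceEntropy (segment k) (ball δ Γ) +
        ((Real.logb 2 (Fintype.card A) * η : ℝ) : EReal) := by
  classical
  refine limsup_le_of_le (by isBoundedDefault) ?_
  filter_upwards [eventually_ge_atTop (max k 1)] with n hn
  have hn0 : (0 : ℝ) < (n : ℝ) ^ d := by
    have : 0 < n := by omega
    positivity
  set B := blocks (axialWindow d k) (ball ε (axialProduct d Γ)) n with hB
  have hcard : B.ncard = Fintype.card B := by
    rw [← Nat.card_coe_set_eq, Nat.card_eq_fintype_card]
  unfold log2Card
  split_ifs with h0
  -- Without admissible blocks the left side is `⊥`.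
  · rw [EReal.bot_div_of_pos_ne_top (EReal.coe_pos.2 hn0) (EReal.coe_ne_top _)]
    exact bot_le
  · rw [← EReal.coe_div, hcard]
    rw [hcard] at h0
    have : Nonempty B := Fintype.card_pos_iff.1 (Nat.pos_of_ne_zero h0)
    exact logb_card_div_le (fun x : B => x.1) Subtype.val_injective hconv (by omega) (by omega)
      hd hm (fun x => x.2) hδ

theorem limsup_capacity_le {Γ : Set ((Fin k → A) → ℝ)} (hconv : Convex ℝ Γ) :
    limsup (fun d : ℕ => capacity (axialWindow d k) (axialProduct d Γ)) atTop ≤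
      independenceEntropy (segment k) Γ := by
  set lA := Real.logb 2 (Fintype.card A) with hlA
  have hlA0 : 0 ≤ lA := by
    rcases Nat.eq_zero_or_pos (Fintype.card A) with h | h
    · simp [hlA, h]
    · exact Real.logb_nonneg (by norm_num) (by exact_mod_cast h)
  have hstep : ∀ e : ℝ, 0 < e →
      limsup (fun d : ℕ => capacity (axialWindow d k) (axialProduct d Γ)) atTop ≤
        internalIndependenceEntropy (segment k) (ball e Γ) + (e : EReal) := by
    intro e he
    -- Chosen so that `lA * η ≤ e` and `√(lA * η) ≤ e / 4`; the `+ 1` covers `lA = 0`. With ball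
    -- radius `e / 4` the total displacement stays below `e`.
    set η := min e ((e / 4) ^ 2) / (lA + 1) with hη
    have hmin : 0 < min e ((e / 4) ^ 2) := lt_min he (by positivity)
    have hη0 : 0 < η := by positivity
    have hs : lA * η ≤ min e ((e / 4) ^ 2) := by
      rw [hη, mul_div_assoc', div_le_iff₀ (by positivity)]
      nlinarith
    have hs1 : √(lA * η) ≤ e / 4 := by
      rw [Real.sqrt_le_left (by positivity)]
      exact hs.trans (min_le_right _ _)
    obtain ⟨m, d₀, hd₀⟩ := exists_forall_density_le k hη0
    refine limsup_le_of_le (by isBoundedDefault) ?_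
    filter_upwards [eventually_ge_atTop d₀] with d hd
    have h1 : capacity (axialWindow d k) (axialProduct d Γ) ≤
        internalCapacity (axialWindow d k) (ball (e / 4) (axialProduct d Γ)) := by
      refine le_of_tendsto (tendsto_capacity _ _) ?_
      filter_upwards [Ioo_mem_nhdsGT (show (0 : ℝ) < e / 4 by positivity)] with ε hε
      exact internalCapacity_mono _ (ball_mono _ hε.2.le)
    refine h1.trans ((internalCapacity_axialProduct_le hconv (hd₀ d hd).1 (hd₀ d hd).2
      (show √(lA * η) + e / 4 < e by linarith)).trans ?_)
    refine add_le_add le_rfl ?_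
    exact EReal.coe_le_coe_iff.2 (hs.trans (min_le_left _ _))
  have hid : Tendsto (fun e : ℝ => (e : EReal)) (𝓝[>] (0 : ℝ)) (𝓝 ((0 : ℝ) : EReal)) :=
    (continuous_coe_real_ereal.tendsto 0).mono_left nhdsWithin_le_nhds
  -- Extended addition is continuous here because the second summand tends to a finite limit, even
  -- if the entropy is `⊥`.
  have hlim := (EReal.continuousAt_add (p := (independenceEntropy (segment k) Γ, ((0 : ℝ) : EReal)))
    (Or.inr (EReal.coe_ne_bot 0)) (Or.inr (EReal.coe_ne_top 0))).tendsto.comp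
    ((tendsto_independenceEntropy (segment k) Γ).prodMk_nhds hid)
  rw [EReal.coe_zero, add_zero] at hlim
  refine ge_of_tendsto hlim ?_
  filter_upwards [self_mem_nhdsWithin] with e he
  exact hstep e he

end UpperBound

/-! ### Correcting the axis marginals of a symmetric measure -/

section Perturbation

variable {A : Type*} [Fintype A] [DecidableEq A] {k d : ℕ}

theorem pushforward_pushforward {X Y Z : Type*} [Fintype X] [Fintype Y] [DecidableEq Y]
    [DecidableEq Z] (f : X → Y) (g : Y → Z) (μ : X → ℝ) :
    pushforward g (pushforward f μ) = pushforward (fun x => g (f x)) μ := by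
  funext z
  have h := sum_pushforward_mul f μ fun y => if g y = z then 1 else 0
  simp only [mul_ite, mul_one, mul_zero] at h
  rw [← Finset.sum_filter, ← Finset.sum_filter] at h
  exact h

theorem pushforward_id {X : Type*} [Fintype X] [DecidableEq X] (μ : X → ℝ) :
    pushforward (fun x => x) μ = μ := by
  funext x
  simp [pushforward, Finset.filter_eq']

theorem comp_perm_mem_axialShape (σ : Equiv.Perm (Fin d)) {s : Fin d → ℤ}
    (hs : s ∈ axialShape d k) : s ∘ σ ∈ axialShape d k := by
  obtain ⟨⟨i, j⟩, -, rfl⟩ := Finset.mem_image.1 hs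
  have : (Pi.single i ((j : ℕ) : ℤ) : Fin d → ℤ) ∘ σ = Pi.single (σ.symm i) ((j : ℕ) : ℤ) := by
    funext l
    simp only [Function.comp_apply, Pi.single_apply]
    simp only [Equiv.eq_symm_apply]
  rw [this]
  exact single_mem_axialShape _ _

/-- The action of a permutation of the axes on the window `⋃_i [k] e_i`. -/
def shapePerm (k : ℕ) (σ : Equiv.Perm (Fin d)) : axialShape d k ≃ axialShape d k where
  toFun s := ⟨s.1 ∘ σ, comp_perm_mem_axialShape σ s.2⟩
  invFun s := ⟨s.1 ∘ σ.symm, comp_perm_mem_axialShape σ.symm s.2⟩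
  left_inv s := Subtype.ext (by funext i; simp)
  right_inv s := Subtype.ext (by funext i; simp)

theorem axisRestrict_comp_shapePerm (σ : Equiv.Perm (Fin d)) (i : Fin d)
    (x : axialShape d k → A) :
    axisRestrict i (x ∘ shapePerm k σ) = axisRestrict (σ.symm i) x := by
  funext j
  simp only [axisRestrict, Function.comp_apply, shapePerm, Equiv.coe_fn_mk]
  congr 1
  refine Subtype.ext ?_
  funext l
  simp only [Function.comp_apply, Pi.single_apply, Equiv.eq_symm_apply]

/-- The coordinate sum recovers `j` from `j e_i` whatever the axis, so a word can be written along
all axes at once, consistently at the shared origin. -/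
theorem sum_mem_range {s : Fin d → ℤ} (hs : s ∈ axialShape d k) : (∑ i, s i).toNat < k := by
  obtain ⟨⟨i, j⟩, -, rfl⟩ := Finset.mem_image.1 hs
  simp

/-- The pattern on `⋃_i [k] e_i` that shows the word `a` along every axis. -/
def diagonalPattern (d : ℕ) (a : Fin k → A) : axialShape d k → A :=
  fun s => a ⟨(∑ i, s.1 i).toNat, sum_mem_range s.2⟩

theorem axisRestrict_diagonalPattern (i : Fin d) (a : Fin k → A) :
    axisRestrict i (diagonalPattern d a) = a := by
  funext j
  simp [axisRestrict, diagonalPattern]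

theorem one_sub_prod_le {ι : Type*} (s : Finset ι) {f : ι → ℝ} (h0 : ∀ i, 0 ≤ f i)
    (h1 : ∀ i, f i ≤ 1) : 1 - ∏ i ∈ s, f i ≤ ∑ i ∈ s, (1 - f i) := by
  classical
  induction s using Finset.induction_on with
  | empty => simp
  | insert i s hi ih =>
    rw [Finset.prod_insert hi, Finset.sum_insert hi]
    have := Finset.prod_le_one (s := s) (fun i _ => h0 i) fun i _ => h1 i
    nlinarith [h0 i, h1 i]

/-- A measure on `⋃_i [k] e_i` that is symmetric in the axes can be moved slightly so as to change
its axis marginals to any nearby measure. -/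
theorem exists_axis_marginals_eq (hd : 0 < d) {μ : (axialShape d k → A) → ℝ}
    (hμ : μ ∈ stdSimplex ℝ (axialShape d k → A))
    (hsym : ∀ (σ : Equiv.Perm (Fin d)) x, μ (x ∘ shapePerm k σ) = μ x) {μ₁ ν : (Fin k → A) → ℝ}
    (hμ₁ : ∀ i, pushforward (axisRestrict i) μ = μ₁) (hν : ν ∈ stdSimplex ℝ (Fin k → A)) :
    ∃ μ' ∈ stdSimplex ℝ (axialShape d k → A), (∀ i, pushforward (axisRestrict i) μ' = ν) ∧
      tvDist μ μ' ≤ 2 * d * tvDist μ₁ ν := by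
  have hμ₁s : μ₁ ∈ stdSimplex ℝ (Fin k → A) :=
    hμ₁ ⟨0, hd⟩ ▸ pushforward_mem_stdSimplex _ hμ
  -- `r a` is the fraction of the mass of `a` that may be kept without exceeding `ν a`; where `μ₁ a
  -- = 0` division gives 0.
  set r : (Fin k → A) → ℝ := fun a => min (μ₁ a) (ν a) / μ₁ a with hr
  have hr0 : ∀ a, 0 ≤ r a := fun a => div_nonneg (le_min (hμ₁s.1 a) (hν.1 a)) (hμ₁s.1 a)
  have hr1 : ∀ a, r a ≤ 1 := fun a => div_le_one_of_le₀ (min_le_left _ _) (hμ₁s.1 a)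
  have hrmul : ∀ a, μ₁ a * r a = min (μ₁ a) (ν a) := by
    intro a
    by_cases h : μ₁ a = 0
    · rw [h, zero_mul, min_eq_left (hν.1 a)]
    · simp only [hr]
      field_simp
  -- Thinning by the product over all axes keeps every axis marginal below `ν` and preserves the
  -- symmetry in the axes.
  set g : (axialShape d k → A) → ℝ := fun x => ∏ i, r (axisRestrict i x) with hg
  have hg0 : ∀ x, 0 ≤ g x := fun x => Finset.prod_nonneg fun i _ => hr0 _
  have hgr : ∀ x i, g x ≤ r (axisRestrict i x) := by
    intro x i
    simp only [hg]
    rw [← Finset.mul_prod_erase _ _ (Finset.mem_univ i)]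
    exact mul_le_of_le_one_right (hr0 _) (Finset.prod_le_one (fun i _ => hr0 _) fun i _ => hr1 _)
  have hg1 : ∀ x, g x ≤ 1 := fun x => Finset.prod_le_one (fun i _ => hr0 _) fun i _ => hr1 _
  have hgsym : ∀ (σ : Equiv.Perm (Fin d)) x, g (x ∘ shapePerm k σ) = g x := by
    intro σ x
    simp only [hg, axisRestrict_comp_shapePerm]
    exact Equiv.prod_comp σ.symm fun i => r (axisRestrict i x)
  set κ : (axialShape d k → A) → ℝ := fun x => μ x * g x with hκ
  have hκ0 : ∀ x, 0 ≤ κ x := fun x => mul_nonneg (hμ.1 x) (hg0 x)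
  have hκμ : ∀ x, κ x ≤ μ x := fun x => mul_le_of_le_one_right (hμ.1 x) (hg1 x)
  set i₀ : Fin d := ⟨0, hd⟩
  have hκi : ∀ i, pushforward (axisRestrict i) κ = pushforward (axisRestrict i₀) κ := by
    intro i
    funext a
    simp only [pushforward, Finset.sum_filter]
    refine Fintype.sum_equiv (Equiv.arrowCongr (shapePerm k (Equiv.swap i i₀)) (Equiv.refl A)) _ _
      fun x => ?_
    have hx : Equiv.arrowCongr (shapePerm k (Equiv.swap i i₀)) (Equiv.refl A) x =
        x ∘ shapePerm k (Equiv.swap i i₀) := by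
      funext s
      simp [Equiv.arrowCongr, shapePerm]
    rw [hx, axisRestrict_comp_shapePerm, Equiv.symm_swap, Equiv.swap_apply_right]
    simp only [hκ, hsym, hgsym]
  have hκν : ∀ a, pushforward (axisRestrict i₀) κ a ≤ ν a := by
    intro a
    calc pushforward (axisRestrict i₀) κ a ≤ pushforward (axisRestrict i₀) μ a * r a := by
          simp only [pushforward, Finset.sum_mul]
          refine Finset.sum_le_sum fun x hx => ?_
          rw [← (Finset.mem_filter.1 hx).2]
          exact mul_le_mul_of_nonneg_left (hgr x i₀) (hμ.1 x)
      _ = min (μ₁ a) (ν a) := by rw [hμ₁, hrmul]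
      _ ≤ ν a := min_le_right _ _
  -- By symmetry this deficit is the same on every axis, so placing it on diagonal patterns repairs
  -- all axes simultaneously.
  set τ : (Fin k → A) → ℝ := fun a => ν a - pushforward (axisRestrict i₀) κ a with hτ
  have hτ0 : ∀ a, 0 ≤ τ a := fun a => sub_nonneg.2 (hκν a)
  have hτsum : ∑ a, τ a = 1 - ∑ x, κ x := by
    simp only [hτ, Finset.sum_sub_distrib, hν.2, sum_pushforward]
  set D := pushforward (diagonalPattern (A := A) (k := k) d) τ with hD
  have hD0 : ∀ x, 0 ≤ D x := fun x => Finset.sum_nonneg fun a _ => hτ0 a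
  have hDsum : ∑ x, D x = 1 - ∑ x, κ x := by rw [hD, sum_pushforward, hτsum]
  -- A union bound over the axes: each removes mass at most `∑ a, |μ₁ a - ν a|`, which is twice the
  -- total variation distance.
  have hloss : 1 - ∑ x, κ x ≤ 2 * d * tvDist μ₁ ν := by
    calc 1 - ∑ x, κ x = ∑ x, μ x * (1 - g x) := by
          simp only [mul_sub, mul_one, Finset.sum_sub_distrib, hμ.2, hκ]
      _ ≤ ∑ x, μ x * ∑ i, (1 - r (axisRestrict i x)) :=
          Finset.sum_le_sum fun x _ => mul_le_mul_of_nonneg_left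
            (one_sub_prod_le _ (fun i => hr0 _) fun i => hr1 _) (hμ.1 x)
      _ = ∑ i, ∑ x, μ x * (1 - r (axisRestrict i x)) := by
          simp only [Finset.mul_sum]
          exact Finset.sum_comm
      _ = ∑ _i : Fin d, ∑ a, μ₁ a * (1 - r a) := by
          refine Finset.sum_congr rfl fun i _ => ?_
          rw [← sum_pushforward_mul (axisRestrict i) μ fun a => 1 - r a, hμ₁]
      _ ≤ ∑ _i : Fin d, ∑ a, |μ₁ a - ν a| := by
          gcongr with i _ a
          rw [mul_sub, mul_one, hrmul]
          rcases min_cases (μ₁ a) (ν a) with h | h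
          · rw [h.1, sub_self]
            exact abs_nonneg _
          · rw [h.1]
            exact le_abs_self _
      _ = 2 * d * tvDist μ₁ ν := by
          simp only [Finset.sum_const, nsmul_eq_mul, Finset.card_univ, Fintype.card_fin, tvDist]
          ring
  have hpush : ∀ i, pushforward (axisRestrict i) (fun x => κ x + D x) = ν := by
    intro i
    have h1 : pushforward (axisRestrict i) D = τ := by
      rw [hD, pushforward_pushforward]
      simp only [axisRestrict_diagonalPattern]
      exact pushforward_id τ
    funext a
    have h2 : pushforward (axisRestrict i) (fun x => κ x + D x) a =
        pushforward (axisRestrict i) κ a + pushforward (axisRestrict i) D a := by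
      simp only [pushforward, Finset.sum_add_distrib]
    rw [h2, h1, hκi]
    simp only [hτ]
    ring
  refine ⟨fun x => κ x + D x, ⟨fun x => add_nonneg (hκ0 x) (hD0 x), ?_⟩, hpush, ?_⟩
  · rw [Finset.sum_add_distrib, hDsum]
    ring
  · calc tvDist μ (fun x => κ x + D x) ≤ 1 / 2 * ∑ x, ((μ x - κ x) + D x) := by
          unfold tvDist
          gcongr with x
          rw [abs_le]
          constructor <;> linarith [hκμ x, hD0 x]
      _ = 1 - ∑ x, κ x := by
          rw [Finset.sum_add_distrib, Finset.sum_sub_distrib, hDsum, hμ.2]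
          ring
      _ ≤ _ := hloss

end Perturbation

/-! ### Law of large numbers and typical words -/

section LargeNumbers

variable {A : Type*} [Fintype A] [DecidableEq A] {d n : ℕ} {ι : Type*} [Fintype ι] [DecidableEq ι]

theorem pushforward_pattern_productMeasure {p : ι → Fin d → ℤ} {q : Cube d n → A → ℝ}
    (hq : ∀ v, q v ∈ stdSimplex ℝ A) {v : Cube d n}
    (hp : Function.Injective fun j => cyclicAdd v (p j)) :
    pushforward (pattern p v) (productMeasure q) =
      productMeasure fun j => q (cyclicAdd v (p j)) :=
  pushforward_productMeasure hq hp

theorem sum_productMeasure_mul_indicator {p : ι → Fin d → ℤ} {q : Cube d n → A → ℝ} {v : Cube d n}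
    (a : ι → A) : ∑ w, productMeasure q w * (if pattern p v w = a then 1 else 0) =
      pushforward (pattern p v) (productMeasure q) a := by
  simp only [mul_ite, mul_one, mul_zero, ← Finset.sum_filter]
  rfl

theorem pushforward_pattern_mem_Icc {p : ι → Fin d → ℤ} {q : Cube d n → A → ℝ}
    (hq : ∀ v, q v ∈ stdSimplex ℝ A) (v : Cube d n) (a : ι → A) :
    pushforward (pattern p v) (productMeasure q) a ∈ Set.Icc (0 : ℝ) 1 := by
  have h := pushforward_mem_stdSimplex (pattern (A := A) p v) (productMeasure_mem_stdSimplex hq)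
  exact ⟨h.1 a, h.2 ▸ Finset.single_le_sum (fun b _ => h.1 b) (Finset.mem_univ a)⟩

open scoped Classical in
-- Windows without a common point are independent and have covariance 0; otherwise the trivial bound
-- 1 is enough.
theorem covariance_indicator_le {p : ι → Fin d → ℤ} {q : Cube d n → A → ℝ}
    (hq : ∀ v, q v ∈ stdSimplex ℝ A)
    (hp : ∀ v : Cube d n, Function.Injective fun j => cyclicAdd v (p j)) (a : ι → A)
    (v u : Cube d n) :
    ∑ w, productMeasure q w *
      (((if pattern p v w = a then 1 else 0) - pushforward (pattern p v) (productMeasure q) a) *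
        ((if pattern p u w = a then 1 else 0) - pushforward (pattern p u) (productMeasure q) a)) ≤
      if ∃ i j, cyclicAdd v (p i) = cyclicAdd u (p j) then 1 else 0 := by
  have hP := productMeasure_mem_stdSimplex hq
  set P := productMeasure q with hPdef
  set ev := pushforward (pattern p v) P a with hev
  set eu := pushforward (pattern p u) P a with heu
  have hv := pushforward_pattern_mem_Icc (p := p) hq v a
  have hu := pushforward_pattern_mem_Icc (p := p) hq u a
  split_ifs with h
  · calc _ ≤ ∑ w, P w * 1 := by
          refine Finset.sum_le_sum fun w _ => mul_le_mul_of_nonneg_left ?_ (hP.1 w)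
          refine (le_abs_self _).trans ?_
          rw [abs_mul]
          refine mul_le_one₀ ?_ (abs_nonneg _) ?_
          · rw [abs_le]
            split_ifs <;> constructor <;> linarith [hv.1, hv.2]
          · rw [abs_le]
            split_ifs <;> constructor <;> linarith [hu.1, hu.2]
      _ = 1 := by simp [hP.2]
  · have hinj : Function.Injective (Sum.elim (fun j => cyclicAdd v (p j))
        (fun j => cyclicAdd u (p j))) := by
      refine Function.Injective.sumElim (hp v) (hp u) fun i j hij => h ⟨i, j, hij⟩
    have hjoint : ∑ w, P w * ((if pattern p v w = a then 1 else 0) *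
        (if pattern p u w = a then 1 else 0)) = ev * eu := by
      have h1 := sum_productMeasure_mul hq hinj fun b =>
        (if (fun j => b (Sum.inl j)) = a then (1 : ℝ) else 0) *
          (if (fun j => b (Sum.inr j)) = a then 1 else 0)
      refine h1.trans ?_
      rw [Finset.sum_eq_single (Sum.elim a a)]
      · rw [hev, heu, hPdef, pushforward_pattern_productMeasure hq (hp v),
          pushforward_pattern_productMeasure hq (hp u)]
        simp [productMeasure]
      · intro b _ hb
        have : ¬((fun j => b (Sum.inl j)) = a ∧ (fun j => b (Sum.inr j)) = a) := by
          rintro ⟨e1, e2⟩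
          refine hb (funext fun s => ?_)
          rcases s with j | j
          · exact congrFun e1 j
          · exact congrFun e2 j
        rw [not_and_or] at this
        rcases this with h | h <;> simp [h]
      · simp
    have h1 := sum_productMeasure_mul_indicator (p := p) (q := q) (v := v) a
    have h2 := sum_productMeasure_mul_indicator (p := p) (q := q) (v := u) a
    rw [← hPdef, ← hev] at h1
    rw [← hPdef, ← heu] at h2
    refine le_of_eq ?_
    calc _ = ∑ w, (P w * ((if pattern p v w = a then 1 else 0) *
            (if pattern p u w = a then 1 else 0)) - (P w * (if pattern p v w = a then 1 else 0)) * eu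
            - (P w * (if pattern p u w = a then 1 else 0)) * ev + P w * (ev * eu)) :=
          Finset.sum_congr rfl fun w _ => by ring
      _ = 0 := by
          rw [Finset.sum_add_distrib, Finset.sum_sub_distrib, Finset.sum_sub_distrib,
            ← Finset.sum_mul, ← Finset.sum_mul, ← Finset.sum_mul, hjoint, h1, h2, hP.2]
          ring

theorem sum_sq_empirical_sub_le {p : ι → Fin d → ℤ} {q : Cube d n → A → ℝ} (hn : 0 < n)
    (hq : ∀ v, q v ∈ stdSimplex ℝ A)
    (hp : ∀ v : Cube d n, Function.Injective fun j => cyclicAdd v (p j)) (a : ι → A) :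
    ∑ w, productMeasure q w * (empirical p w a - averageMarginal p (productMeasure q) a) ^ 2 ≤
      (Fintype.card ι : ℝ) ^ 2 / (n : ℝ) ^ d := by
  classical
  have hn' : (0 : ℝ) < (n : ℝ) ^ d := by positivity
  set P := productMeasure q with hPdef
  set Z : Cube d n → (Cube d n → A) → ℝ := fun v w =>
    (if pattern p v w = a then 1 else 0) - pushforward (pattern p v) P a with hZ
  have h1 : ∀ w, (empirical p w a - averageMarginal p P a) ^ 2 =
      (1 / (n : ℝ) ^ d) ^ 2 * ∑ v, ∑ u, Z v w * Z u w := by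
    intro w
    rw [← Finset.sum_mul_sum, empirical, averageMarginal, ← mul_sub, ← Finset.sum_sub_distrib,
      mul_pow, sq (∑ v, _)]
  -- A window meeting the one at `v` is determined by the pair of positions at which they coincide.
  have hcount : ∀ v : Cube d n, ∑ u : Cube d n,
      (if ∃ i j, cyclicAdd v (p i) = cyclicAdd u (p j) then (1 : ℝ) else 0) ≤
        (Fintype.card ι : ℝ) ^ 2 := by
    intro v
    rw [Finset.sum_boole]
    have hsub : (Finset.univ.filter fun u : Cube d n =>
        ∃ i j, cyclicAdd v (p i) = cyclicAdd u (p j)) ⊆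
        (Finset.univ : Finset (ι × ι)).image fun ij =>
          (translate (p ij.2)).symm (cyclicAdd v (p ij.1)) := by
      intro u hu
      obtain ⟨i, j, hij⟩ := (Finset.mem_filter.1 hu).2
      refine Finset.mem_image.2 ⟨(i, j), Finset.mem_univ _, ?_⟩
      rw [Equiv.symm_apply_eq]
      exact hij
    have := (Finset.card_le_card hsub).trans Finset.card_image_le
    rw [Finset.card_univ, Fintype.card_prod] at this
    rw [sq]
    exact_mod_cast this
  calc ∑ w, P w * (empirical p w a - averageMarginal p P a) ^ 2
      = (1 / (n : ℝ) ^ d) ^ 2 * ∑ v, ∑ u, ∑ w, P w * (Z v w * Z u w) := by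
        simp only [h1, Finset.mul_sum]
        rw [Finset.sum_comm]
        refine Finset.sum_congr rfl fun v _ => ?_
        rw [Finset.sum_comm]
        exact Finset.sum_congr rfl fun u _ => Finset.sum_congr rfl fun w _ => by ring
    _ ≤ (1 / (n : ℝ) ^ d) ^ 2 * ∑ v : Cube d n, (Fintype.card ι : ℝ) ^ 2 := by
        gcongr with v
        exact (Finset.sum_le_sum fun u _ => covariance_indicator_le hq hp a v u).trans (hcount v)
    _ = (Fintype.card ι : ℝ) ^ 2 / (n : ℝ) ^ d := by
        rw [Finset.sum_const, nsmul_eq_mul, Finset.card_univ, card_cube]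
        field_simp

/-- A weak law of large numbers: Chebyshev's inequality for the empirical distribution. -/
theorem sum_tvDist_gt_le {p : ι → Fin d → ℤ} {q : Cube d n → A → ℝ} (hn : 0 < n)
    (hq : ∀ v, q v ∈ stdSimplex ℝ A)
    (hp : ∀ v : Cube d n, Function.Injective fun j => cyclicAdd v (p j)) {η : ℝ} (hη : 0 < η) :
    ∑ w with η < tvDist (empirical p w) (averageMarginal p (productMeasure q)),
      productMeasure q w ≤
      (Fintype.card (ι → A) : ℝ) ^ 2 * (Fintype.card ι : ℝ) ^ 2 / η ^ 2 / (n : ℝ) ^ d := by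
  have hP := productMeasure_mem_stdSimplex hq
  set P := productMeasure q with hPdef
  set m := averageMarginal p P with hm
  set C : ℝ := (Fintype.card (ι → A) : ℝ) with hC
  have htv : ∀ w : Cube d n → A, tvDist (empirical p w) m ^ 2 ≤ C * ∑ a, (empirical p w a - m a) ^ 2 := by
    intro w
    have h1 : (∑ a, |empirical p w a - m a|) ^ 2 ≤ C * ∑ a, |empirical p w a - m a| ^ 2 := by
      rw [hC, ← Finset.card_univ]
      exact sq_sum_le_card_mul_sum_sq
    simp only [sq_abs] at h1
    rw [tvDist, mul_pow]
    nlinarith [sq_nonneg (∑ a, |empirical p w a - m a|)]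
  have h2 : η ^ 2 * ∑ w with η < tvDist (empirical p w) m, P w ≤
      C * (C * ((Fintype.card ι : ℝ) ^ 2 / (n : ℝ) ^ d)) := by
    calc η ^ 2 * ∑ w with η < tvDist (empirical p w) m, P w
        ≤ ∑ w with η < tvDist (empirical p w) m, P w * (C * ∑ a, (empirical p w a - m a) ^ 2) := by
          rw [Finset.mul_sum]
          refine Finset.sum_le_sum fun w hw => ?_
          rw [mul_comm]
          refine mul_le_mul_of_nonneg_left (le_trans ?_ (htv w)) (hP.1 w)
          have := (Finset.mem_filter.1 hw).2
          gcongr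
      _ ≤ ∑ w, P w * (C * ∑ a, (empirical p w a - m a) ^ 2) := by
          refine Finset.sum_le_sum_of_subset_of_nonneg (Finset.subset_univ _) fun w _ _ => ?_
          have := hP.1 w
          positivity
      _ = C * ∑ a, ∑ w, P w * (empirical p w a - m a) ^ 2 := by
          rw [Finset.sum_comm, Finset.mul_sum]
          refine Finset.sum_congr rfl fun w _ => ?_
          rw [← Finset.mul_sum]
          ring
      _ ≤ C * ∑ _a : ι → A, (Fintype.card ι : ℝ) ^ 2 / (n : ℝ) ^ d := by
          gcongr with a
          exact sum_sq_empirical_sub_le hn hq hp a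
      _ = _ := by simp [hC]
  have h3 : ∑ w with η < tvDist (empirical p w) m, P w ≤
      C * (C * ((Fintype.card ι : ℝ) ^ 2 / (n : ℝ) ^ d)) / η ^ 2 := by
    rw [le_div_iff₀ (by positivity)]
    linarith
  refine h3.trans (le_of_eq ?_)
  field_simp

/-- Gibbs' inequality against the equal mixture of the uniform laws on `T` and on `X`: the mixture
weight costs one bit, and points outside `T` cost at most `log |X|` more. -/
theorem entropy_le_of_concentrated {X : Type*} [Fintype X] [DecidableEq X] {P : X → ℝ}
    (hP : P ∈ stdSimplex ℝ X) {T : Finset X} (hT : T.Nonempty) {δ : ℝ} (hδ : ∑ x ∈ Tᶜ, P x ≤ δ) :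
    entropy P ≤ 1 + Real.logb 2 T.card + δ * Real.logb 2 (Fintype.card X) := by
  have hTc : (0 : ℝ) < T.card := by exact_mod_cast hT.card_pos
  have hX : 0 < Fintype.card X := Fintype.card_pos_iff.2 ⟨hT.choose⟩
  have hXc : (0 : ℝ) < Fintype.card X := by exact_mod_cast hX
  have hlX : 0 ≤ Real.logb 2 (Fintype.card X) :=
    Real.logb_nonneg (by norm_num) (by exact_mod_cast hX)
  have hlT : 0 ≤ Real.logb 2 T.card :=
    Real.logb_nonneg (by norm_num) (by exact_mod_cast hT.card_pos)
  set r : X → ℝ := fun x => (if x ∈ T then 1 / (2 * T.card : ℝ) else 0) + 1 / (2 * Fintype.card X)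
    with hr
  have hr0 : ∀ x, 0 < r x := fun x => by
    simp only [hr]
    split_ifs <;> positivity
  have hrsum : ∑ x, r x ≤ 1 := by
    simp only [hr, Finset.sum_add_distrib, Finset.sum_ite_mem, Finset.univ_inter, Finset.sum_const,
      nsmul_eq_mul, Finset.card_univ]
    refine le_of_eq ?_
    field_simp
    norm_num
  refine (entropy_le_cross_entropy hP (fun x => (hr0 x).le) hrsum fun x _ => (hr0 x).ne').trans ?_
  rw [← Finset.sum_neg_distrib]
  have hterm : ∀ x, -(P x * Real.logb 2 (r x)) ≤ P x * (1 + Real.logb 2 T.card) +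
      if x ∈ Tᶜ then P x * Real.logb 2 (Fintype.card X) else 0 := by
    intro x
    have hlog : ∀ c : ℝ, 0 < c → c⁻¹ / 2 ≤ r x → -Real.logb 2 (r x) ≤ 1 + Real.logb 2 c := by
      intro c hc hcr
      have h1 := Real.logb_le_logb_of_le (b := 2) (by norm_num) (by positivity) hcr
      rw [Real.logb_div (by positivity) (by norm_num), Real.logb_inv,
        Real.logb_self_eq_one (by norm_num)] at h1
      linarith
    by_cases hx : x ∈ T
    · have h1 := hlog T.card hTc (by
        simp only [hr, if_pos hx]
        have : (0 : ℝ) < 1 / (2 * Fintype.card X) := by positivity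
        have e : (T.card : ℝ)⁻¹ / 2 = 1 / (2 * T.card) := by field_simp
        linarith)
      simp only [Finset.mem_compl, hx, not_true_eq_false, if_false, add_zero]
      nlinarith [hP.1 x]
    · have h1 := hlog (Fintype.card X) hXc (by
        simp only [hr, if_neg hx, zero_add]
        refine le_of_eq ?_
        field_simp)
      simp only [Finset.mem_compl, hx, not_false_eq_true, if_true]
      nlinarith [hP.1 x, mul_nonneg (hP.1 x) hlT]
  refine (Finset.sum_le_sum fun x _ => hterm x).trans ?_
  rw [Finset.sum_add_distrib, ← Finset.sum_mul, hP.2, Finset.sum_ite_mem, Finset.univ_inter,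
    ← Finset.sum_mul, one_mul]
  gcongr

end LargeNumbers

/-! ### Spreading a periodic product measure over levels -/

section PeriodicExtension

variable {A : Type*} [Fintype A] [DecidableEq A] {k d n N : ℕ}

/-- The periodic extension to `ℤ` of a function on the one-dimensional cube. -/
def periodicExtension {β : Type*} (hn : 0 < n) (f : Cube 1 n → β) (z : ℤ) : β :=
  f (cyclicAdd (fun _ => ⟨0, hn⟩) fun _ => z)

theorem periodicExtension_congr {β : Type*} (hn : 0 < n) (f : Cube 1 n → β) {y z : ℤ}
    (h : y ≡ z [ZMOD n]) : periodicExtension hn f y = periodicExtension hn f z := by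
  unfold periodicExtension
  congr 1
  rw [cyclicAdd_eq_cyclicAdd_iff]
  intro _
  simpa using h

theorem periodicExtension_add (hn : 0 < n) {β : Type*} (f : Cube 1 n → β) (u : Cube 1 n) (z : ℤ) :
    periodicExtension hn f (((u 0 : ℕ) : ℤ) + z) = f (cyclicAdd u fun _ => z) := by
  unfold periodicExtension
  congr 1
  rw [cyclicAdd_eq_cyclicAdd_iff]
  intro i
  rw [Subsingleton.elim i 0]
  simp

theorem periodicExtension_apply (hn : 0 < n) {β : Type*} (f : Cube 1 n → β) (u : Cube 1 n) :
    periodicExtension hn f ((u 0 : ℕ) : ℤ) = f u := by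
  have h := periodicExtension_add hn f u 0
  rw [add_zero] at h
  rw [h]
  congr 1
  exact cyclicAdd_zero u

/-- The sum of the coordinates. -/
def level (v : Cube d N) : ℤ := ∑ i, ((v i : ℕ) : ℤ)

theorem level_cyclicAdd_modEq (hnN : n ∣ N) (v : Cube d N) (s : Fin d → ℤ) :
    level (cyclicAdd v s) ≡ level v + ∑ i, s i [ZMOD n] := by
  unfold level
  rw [← Finset.sum_add_distrib]
  refine Int.ModEq.of_dvd (Int.natCast_dvd_natCast.2 hnN) ?_
  rw [Int.modEq_iff_dvd, ← Finset.sum_sub_distrib]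
  exact Finset.dvd_sum fun i _ => (Int.modEq_iff_dvd).1 (cyclicAdd_modEq v s i)

/-- Levels are equidistributed modulo `n`: a translation along one axis permutes the torus and
shifts the level, so one may average over all `n` shifts. -/
theorem sum_level (hd : 0 < d) (hnN : n ∣ N) {G : ℤ → ℝ}
    (hG : ∀ y z, y ≡ z [ZMOD n] → G y = G z) :
    (n : ℝ) * ∑ v : Cube d N, G (level v) =
      (N : ℝ) ^ d * ∑ u : Cube 1 n, G ((u 0 : ℕ) : ℤ) := by
  have h1 : ∀ t : ℕ, ∑ v : Cube d N, G (level v + t) = ∑ v : Cube d N, G (level v) := by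
    intro t
    rw [← sum_cyclicAdd (Pi.single (⟨0, hd⟩ : Fin d) (t : ℤ)) fun v => G (level v)]
    refine Finset.sum_congr rfl fun v _ => (hG _ _ ?_).symm
    simpa using level_cyclicAdd_modEq hnN v (Pi.single (⟨0, hd⟩ : Fin d) (t : ℤ))
  have h2 : ∀ c : ℤ, ∑ u : Cube 1 n, G (c + (u 0 : ℕ)) = ∑ u : Cube 1 n, G ((u 0 : ℕ) : ℤ) := by
    intro c
    rw [← sum_cyclicAdd (n := n) (fun _ => c) fun u => G ((u 0 : ℕ) : ℤ)]
    refine Finset.sum_congr rfl fun u _ => hG _ _ ?_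
    rw [add_comm]
    exact (cyclicAdd_modEq u (fun _ => c) 0).symm
  calc (n : ℝ) * ∑ v : Cube d N, G (level v)
      = ∑ u : Cube 1 n, ∑ v : Cube d N, G (level v + (u 0 : ℕ)) := by
        simp only [h1, Finset.sum_const, nsmul_eq_mul, Finset.card_univ, card_cube, pow_one]
    _ = ∑ v : Cube d N, ∑ u : Cube 1 n, G (level v + (u 0 : ℕ)) := Finset.sum_comm
    _ = _ := by simp only [h2, Finset.sum_const, nsmul_eq_mul, Finset.card_univ, card_cube]

theorem axialWindow_injective (hk : k ≤ N) (v : Cube d N) :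
    Function.Injective fun s : axialShape d k => cyclicAdd v (axialWindow d k s) := by
  have hbound : ∀ s ∈ axialShape d k, ∀ i, 0 ≤ s i ∧ s i < N := by
    intro s hs i
    obtain ⟨⟨i', j⟩, -, rfl⟩ := Finset.mem_image.1 hs
    have := j.isLt
    simp only [Pi.single_apply]
    split_ifs <;> omega
  intro s t h
  simp only at h
  rw [cyclicAdd_eq_cyclicAdd_iff] at h
  refine Subtype.ext (funext fun i => ?_)
  have h1 := Int.ModEq.add_left_cancel' _ (h i)
  have hs := hbound s.1 s.2 i
  have ht := hbound t.1 t.2 i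
  rw [Int.ModEq, axialWindow, Int.emod_eq_of_lt hs.1 hs.2, Int.emod_eq_of_lt ht.1 ht.2] at h1
  exact h1

theorem segment_injective (hk : k ≤ n) (u : Cube 1 n) :
    Function.Injective fun j : Fin k => cyclicAdd u (segment k j) := by
  intro j j' h
  simp only at h
  rw [cyclicAdd_eq_cyclicAdd_iff] at h
  have h1 := Int.ModEq.add_left_cancel' _ (h 0)
  have hj := j.isLt
  have hj' := j'.isLt
  rw [Int.ModEq, segment, segment, Int.emod_eq_of_lt (by omega) (by omega),
    Int.emod_eq_of_lt (by omega) (by omega)] at h1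
  exact Fin.ext (by exact_mod_cast h1)

/-- The product measure on the `d`-dimensional cube whose marginals depend only on the level. -/
def levelFamily (d N : ℕ) (hn : 0 < n) (q : Cube 1 n → A → ℝ) (v : Cube d N) : A → ℝ :=
  periodicExtension hn q (level v)

variable {q : Cube 1 n → A → ℝ}

theorem levelFamily_mem (hn : 0 < n) (hq : ∀ u, q u ∈ stdSimplex ℝ A) (v : Cube d N) :
    levelFamily d N hn q v ∈ stdSimplex ℝ A := hq _

theorem levelFamily_cyclicAdd (hn : 0 < n) (hnN : n ∣ N) (v : Cube d N) (s : Fin d → ℤ) :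
    levelFamily d N hn q (cyclicAdd v s) = periodicExtension hn q (level v + ∑ i, s i) :=
  periodicExtension_congr hn q (level_cyclicAdd_modEq hnN v s)

theorem entropy_levelFamily (hd : 0 < d) (hn : 0 < n) (hnN : n ∣ N)
    (hq : ∀ u, q u ∈ stdSimplex ℝ A) :
    entropy (productMeasure (levelFamily d N hn q)) =
      (N : ℝ) ^ d * (1 / (n : ℝ) ^ 1 * entropy (productMeasure q)) := by
  have hn' : (n : ℝ) ≠ 0 := by exact_mod_cast hn.ne'
  rw [entropy_productMeasure (levelFamily_mem hn hq), entropy_productMeasure hq]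
  have h := sum_level hd hnN (G := fun z => entropy (periodicExtension hn q z))
    fun y z h => by rw [periodicExtension_congr hn q h]
  simp only [periodicExtension_apply] at h
  simp only [levelFamily]
  field_simp
  linarith

theorem averageMarginal_levelFamily (hn : 0 < n) (hnN : n ∣ N) (hk : k ≤ N)
    (hq : ∀ u, q u ∈ stdSimplex ℝ A) (x : axialShape d k → A) :
    averageMarginal (axialWindow d k) (productMeasure (levelFamily d N hn q)) x =
      1 / (N : ℝ) ^ d * ∑ v : Cube d N, ∏ s : axialShape d k,
        periodicExtension hn q (level v + ∑ i, s.1 i) (x s) := by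
  rw [averageMarginal]
  congr 1
  refine Finset.sum_congr rfl fun v _ => ?_
  rw [pushforward_pattern_productMeasure (levelFamily_mem hn hq) (axialWindow_injective hk v)]
  simp only [productMeasure, levelFamily_cyclicAdd hn hnN, axialWindow]

/-- Permuting axes preserves coordinate sums, on which alone the laws depend. This is the symmetry
used in correcting the axis marginals. -/
theorem averageMarginal_levelFamily_comp (hn : 0 < n) (hnN : n ∣ N) (hk : k ≤ N)
    (hq : ∀ u, q u ∈ stdSimplex ℝ A) (σ : Equiv.Perm (Fin d)) (x : axialShape d k → A) :
    averageMarginal (axialWindow d k) (productMeasure (levelFamily d N hn q))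
        (x ∘ shapePerm k σ) =
      averageMarginal (axialWindow d k) (productMeasure (levelFamily d N hn q)) x := by
  rw [averageMarginal_levelFamily hn hnN hk hq, averageMarginal_levelFamily hn hnN hk hq]
  congr 1
  refine Finset.sum_congr rfl fun v _ => Fintype.prod_equiv (shapePerm k σ) _ _ fun s => ?_
  have : ∑ i, (shapePerm k σ s).1 i = ∑ i, s.1 i := Equiv.sum_comp σ s.1
  rw [this, Function.comp_apply]

/-- A step along any axis raises the level by one, so each axis window reads consecutive laws of
`q`; equidistribution of levels turns the average into the one-dimensional one. -/
theorem pushforward_averageMarginal_levelFamily (hd : 0 < d) (hn : 0 < n) (hnN : n ∣ N)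
    (hN : 0 < N) (hkn : k ≤ n) (hq : ∀ u, q u ∈ stdSimplex ℝ A) (i : Fin d) :
    pushforward (axisRestrict i)
        (averageMarginal (axialWindow d k) (productMeasure (levelFamily d N hn q))) =
      averageMarginal (segment k) (productMeasure q) := by
  have hkN : k ≤ N := hkn.trans (Nat.le_of_dvd hN hnN)
  have hn' : (n : ℝ) ≠ 0 := by exact_mod_cast hn.ne'
  have hN' : (N : ℝ) ^ d ≠ 0 := pow_ne_zero _ (by exact_mod_cast hN.ne')
  funext a
  have h1 : ∀ v : Cube d N, pushforward (axisRestrict i) (pushforward (pattern (axialWindow d k) v)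
      (productMeasure (levelFamily d N hn q))) a =
      ∏ j : Fin k, periodicExtension hn q (level v + (j : ℕ)) (a j) := by
    intro v
    rw [pushforward_pushforward]
    have hφ : Function.Injective fun j : Fin k => axisPoint i v j := fun j j' h =>
      Fin.ext (axisPoint_eq_axisPoint v (by omega) (by omega) h).1
    have h2 := pushforward_productMeasure (levelFamily_mem (d := d) (N := N) hn hq) hφ
    refine (congrFun h2 a).trans ?_
    simp only [productMeasure, axisPoint, levelFamily_cyclicAdd hn hnN,
      Finset.sum_pi_single', Finset.mem_univ, if_true]
  have h3 : pushforward (axisRestrict i)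
      (averageMarginal (axialWindow d k) (productMeasure (levelFamily d N hn q))) a =
      1 / (N : ℝ) ^ d * ∑ v : Cube d N, pushforward (axisRestrict i) (pushforward
        (pattern (axialWindow d k) v) (productMeasure (levelFamily d N hn q))) a := by
    conv_lhs => rw [pushforward]
    simp only [averageMarginal]
    rw [← Finset.mul_sum, Finset.sum_comm]
    rfl
  have h4 : ∀ u : Cube 1 n, pushforward (pattern (segment k) u) (productMeasure q) a =
      ∏ j : Fin k, periodicExtension hn q (((u 0 : ℕ) : ℤ) + (j : ℕ)) (a j) := by
    intro u
    rw [pushforward_pattern_productMeasure hq (segment_injective hkn u)]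
    simp only [productMeasure, periodicExtension_add]
    rfl
  have h5 := sum_level (d := d) hd hnN
    (G := fun z => ∏ j : Fin k, periodicExtension hn q (z + (j : ℕ)) (a j))
    fun y z h => Finset.prod_congr rfl fun j _ => by
      rw [periodicExtension_congr hn q (h.add_right _)]
  rw [h3, averageMarginal]
  simp only [h1, h4]
  field_simp
  linarith

end PeriodicExtension

/-! ### The lower bound on the capacity -/

section LowerBound

variable {A : Type*} [Fintype A] [DecidableEq A] {k d n : ℕ}

/-- Correcting the axis marginals costs `2 * d` times their distance to `Γ`; the remaining radius
`η` absorbs the fluctuations of the empirical distribution, so all typical words are admissible. -/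
theorem le_internalCapacity_axialProduct {Γ : Set ((Fin k → A) → ℝ)}
    (hΓ : Γ ⊆ stdSimplex ℝ (Fin k → A)) (hd : 0 < d) (hn : 0 < n) (hk : k ≤ n)
    {q : Cube 1 n → A → ℝ} (hq : ∀ u, q u ∈ stdSimplex ℝ A) {ε δ : ℝ}
    (hqΓ : averageMarginal (segment k) (productMeasure q) ∈ ball δ Γ) (hε : 2 * d * δ < ε) :
    ((1 / (n : ℝ) ^ 1 * entropy (productMeasure q) : ℝ) : EReal) ≤
      internalCapacity (axialWindow d k) (ball ε (axialProduct d Γ)) := by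
  classical
  have hd' : (0 : ℝ) < d := by exact_mod_cast hd
  set h := 1 / (n : ℝ) ^ 1 * entropy (productMeasure q) with hh
  set lA := Real.logb 2 (Fintype.card A) with hlA
  obtain ⟨δ', hδ', hδε⟩ : ∃ δ', δ < δ' ∧ 2 * d * δ' < ε := by
    refine ⟨(δ + ε / (2 * d)) / 2, ?_, ?_⟩
    · have : δ < ε / (2 * d) := by rw [lt_div_iff₀ (by positivity)]; linarith
      linarith
    · have e : 2 * (d : ℝ) * ((δ + ε / (2 * d)) / 2) = (2 * d * δ + ε) / 2 := by field_simp
      rw [e]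
      linarith
  obtain ⟨ν, hν, hνδ⟩ := exists_tvDist_lt_of_mem_ball hqΓ hδ'
  set η := ε - 2 * d * δ' with hη
  have hη0 : 0 < η := by linarith
  set C : ℝ := (Fintype.card (axialShape d k → A) : ℝ) ^ 2 *
    (Fintype.card (axialShape d k) : ℝ) ^ 2 / η ^ 2 with hC
  -- Divisibility makes the level modulo `n` survive wrap-around; the last condition ensures that
  -- typical words exist.
  have hmain : ∀ N : ℕ, 0 < N → n ∣ N → C / (N : ℝ) ^ d < 1 →
      ((h - (1 / (N : ℝ) ^ d + C / (N : ℝ) ^ d * lA) : ℝ) : EReal) ≤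
        log2Card (blocks (axialWindow d k) (ball ε (axialProduct d Γ)) N).ncard /
          (((N : ℝ) ^ d : ℝ) : EReal) := by
    intro N hN hnN hCN
    have hkN : k ≤ N := hk.trans (Nat.le_of_dvd hN hnN)
    have hNd : (0 : ℝ) < (N : ℝ) ^ d := by positivity
    have hQ : ∀ v, levelFamily d N hn q v ∈ stdSimplex ℝ A := levelFamily_mem hn hq
    have hP := productMeasure_mem_stdSimplex hQ
    set P := productMeasure (levelFamily d N hn q) with hPdef
    set m := averageMarginal (axialWindow d k) P with hm
    have hms : m ∈ stdSimplex ℝ (axialShape d k → A) := averageMarginal_mem_stdSimplex _ hN hP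
    obtain ⟨μ', hμ', hμ'ν, htv⟩ := exists_axis_marginals_eq hd hms
      (averageMarginal_levelFamily_comp hn hnN hkN hq)
      (pushforward_averageMarginal_levelFamily hd hn hnN hN hk hq) (hΓ hν)
    have hμ'Γ : μ' ∈ axialProduct d Γ := ⟨hμ', fun i => by rw [hμ'ν]; exact hν⟩
    set T : Finset (Cube d N → A) :=
      Finset.univ.filter fun w => ¬ η < tvDist (empirical (axialWindow d k) w) m with hT
    have hTc : Tᶜ = Finset.univ.filter fun w => η < tvDist (empirical (axialWindow d k) w) m := by
      ext w
      simp [hT]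
    have hprob : ∑ w ∈ Tᶜ, P w ≤ C / (N : ℝ) ^ d := by
      rw [hTc]
      exact sum_tvDist_gt_le hN hQ (axialWindow_injective hkN) hη0
    have hTne : T.Nonempty := by
      rw [Finset.nonempty_iff_ne_empty]
      intro h0
      rw [h0, Finset.compl_empty, hP.2] at hprob
      linarith
    have hent := entropy_le_of_concentrated hP hTne hprob
    have hTsub : (T : Set (Cube d N → A)) ⊆
        blocks (axialWindow d k) (ball ε (axialProduct d Γ)) N := by
      intro w hw
      have hw' := not_lt.1 (Finset.mem_filter.1 (Finset.mem_coe.1 hw)).2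
      have hemp : empirical (axialWindow d k) w ∈ stdSimplex ℝ (axialShape d k → A) := by
        refine average_mem_stdSimplex (by rw [card_cube]; field_simp) (by positivity)
          (μ := fun v a => if pattern (axialWindow d k) v w = a then 1 else 0) fun v => ⟨fun a => ?_, ?_⟩
        · beta_reduce
          split_ifs <;> norm_num
        · simp
      refine mem_ball_of_tvDist_le hemp hμ'Γ ((tvDist_triangle _ m _).trans ?_)
      have : 2 * d * tvDist (averageMarginal (segment k) (productMeasure q)) ν ≤ 2 * d * δ' := by
        gcongr
      linarith
    have hcard : T.card ≤ (blocks (axialWindow d k) (ball ε (axialProduct d Γ)) N).ncard := by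
      rw [← Set.ncard_coe_finset]
      exact Set.ncard_le_ncard hTsub (Set.toFinite _)
    have hlog : ((Real.logb 2 T.card : ℝ) : EReal) ≤
        log2Card (blocks (axialWindow d k) (ball ε (axialProduct d Γ)) N).ncard := by
      refine le_trans (le_of_eq ?_) (log2Card_mono hcard)
      rw [log2Card, if_neg hTne.card_pos.ne']
    refine le_trans ?_ (EReal.div_le_div_right_of_nonneg (EReal.coe_nonneg.2 hNd.le) hlog)
    rw [← EReal.coe_div, EReal.coe_le_coe_iff, le_div_iff₀ hNd]
    rw [entropy_levelFamily hd hn hnN hq, ← hh, Fintype.card_fun, Nat.cast_pow, Real.logb_pow,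
      card_cube, ← hlA] at hent
    have e : (h - (1 / (N : ℝ) ^ d + C / (N : ℝ) ^ d * lA)) * (N : ℝ) ^ d =
        (N : ℝ) ^ d * h - 1 - C / (N : ℝ) ^ d * ((N : ℝ) ^ d * lA) := by
      field_simp
      ring
    rw [e]
    linarith
  have hpow : Tendsto (fun N : ℕ => (N : ℝ) ^ d) atTop atTop :=
    (tendsto_pow_atTop hd.ne').comp tendsto_natCast_atTop_atTop
  have hlim1 : Tendsto (fun N : ℕ => C / (N : ℝ) ^ d) atTop (𝓝 0) := hpow.const_div_atTop C
  have hlim2 : Tendsto (fun N : ℕ => h - (1 / (N : ℝ) ^ d + C / (N : ℝ) ^ d * lA)) atTop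
      (𝓝 (h - (0 + 0 * lA))) :=
    ((hpow.const_div_atTop 1).add (hlim1.mul_const lA)).const_sub h
  rw [zero_mul, add_zero, sub_zero] at hlim2
  refine le_of_forall_lt fun c hc => ?_
  obtain ⟨y, hcy, hyh⟩ := EReal.lt_iff_exists_real_btwn.1 hc
  refine hcy.trans_le (le_limsup_of_frequently_le (frequently_atTop.2 fun N₀ => ?_))
  have hev := (hlim1.eventually (gt_mem_nhds (show (0 : ℝ) < 1 by norm_num))).and
    (hlim2.eventually (lt_mem_nhds (EReal.coe_lt_coe_iff.1 hyh)))
  obtain ⟨N₁, hN₁⟩ := eventually_atTop.1 hev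
  -- The side `n * M` is a multiple of `n` and at least `M`; multiples suffice for a limsup.
  set M := max (max N₀ N₁) 1 with hM
  have hle : M ≤ n * M := Nat.le_mul_of_pos_left _ hn
  refine ⟨n * M, by omega, ?_⟩
  obtain ⟨h1, h2⟩ := hN₁ (n * M) (by omega)
  exact (EReal.coe_le_coe_iff.2 h2.le).trans (hmain (n * M) (by omega) (dvd_mul_right _ _) h1)

theorem independenceEntropy_le_capacity_axialProduct {Γ : Set ((Fin k → A) → ℝ)}
    (hΓ : Γ ⊆ stdSimplex ℝ (Fin k → A)) (hd : 0 < d) :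
    independenceEntropy (segment k) Γ ≤ capacity (axialWindow d k) (axialProduct d Γ) := by
  have hd' : (0 : ℝ) < d := by exact_mod_cast hd
  refine ge_of_tendsto (tendsto_capacity _ _) ?_
  filter_upwards [self_mem_nhdsWithin] with ε hε
  have hε0 : (0 : ℝ) < ε := hε
  -- The radius may shrink with `d`, since `d` is fixed here and the independence entropy is a limit
  -- as the radius tends to 0.
  set δ := ε / (4 * d) with hδ
  have hδ0 : 0 < δ := by positivity
  have h2 : 2 * d * δ < ε := by
    have : 2 * (d : ℝ) * δ = ε / 2 := by
      rw [hδ]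
      field_simp
      norm_num
    linarith
  have h1 : independenceEntropy (segment k) Γ ≤
      internalIndependenceEntropy (segment k) (ball δ Γ) := by
    refine le_of_tendsto (tendsto_independenceEntropy _ _) ?_
    filter_upwards [Ioo_mem_nhdsGT hδ0] with e he
    exact internalIndependenceEntropy_mono _ (ball_mono _ he.2.le)
  refine h1.trans (limsup_le_of_le (by isBoundedDefault) ?_)
  filter_upwards [eventually_ge_atTop (max k 1)] with n hn
  refine iSup₂_le fun μ hμ => ?_
  obtain ⟨⟨q, hq, rfl⟩, hqΓ⟩ := hμ
  exact le_internalCapacity_axialProduct hΓ hd (by omega) (by omega) hq hqΓ h2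

end LowerBound

end Semiconstrained

theorem mainTheorem1 {A : Type*} [Fintype A] [DecidableEq A] (k : ℕ)
    (Γ : Set ((Fin k → A) → ℝ)) (hΓ : Γ ⊆ stdSimplex ℝ (Fin k → A)) (hconv : Convex ℝ Γ) :
    limsup (fun d : ℕ => Semiconstrained.capacity (Semiconstrained.axialWindow d k)
        (Semiconstrained.axialProduct d Γ)) atTop =
      Semiconstrained.independenceEntropy (Semiconstrained.segment k) Γ := by
  refine le_antisymm (Semiconstrained.limsup_capacity_le hconv)
    (le_limsup_of_frequently_le (Eventually.frequently ?_))
  filter_upwards [eventually_ge_atTop 1] with d hd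
  exact Semiconstrained.independenceEntropy_le_capacity_axialProduct hΓ hd
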